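/- **Setting.** Let $n\ge 3$ and let $\vec s_1,\dots,\vec s_n$ be directed lines through the origin of $\mathbb R^2$, given by nonzero direction vectors, pairwise non-parallel. Indices are cyclic modulo $n$. Lines $e_1,\dots,e_n\subset\mathbb R^2$ with $e_i$ parallel to $s_i$ define a polygon $Q$ with edge slopes $s_1,\dots,s_n$, with consecutive vertices $v_i=e_i\cap e_{i+1}$, so that the $i$-th edge $v_{i-1}v_i$ lies on $e_i$. The line $e_i$ is directed as $\vec s_i$ and is then denoted $\vec e_i$. The oriented area of $Q$ with $v_i=(x_i,y_i)$ is $\mathcal A(Q)=\frac12\sum_{i=1}^n (x_iy_{i+1}-x_{i+1}y_i)$, and its oriented perimeter is $\mathcal P(Q)=\sum_{i=1}^n \varepsilon_i\,|v_{i-1}v_i|$, where $\varepsilon_i=1$ if $\overrightarrow{v_{i-1}v_i}$ is codirected with $\vec e_i$ and $\varepsilon_i=-1$ otherwise. The polygons with edge slopes $s_1,\dots,s_n$ modulo translations form a real vector space $\widetilde{\mathbf S}$ of dimension $n-2$, and $\mathbf S=\{Q\in\widetilde{\mathbf S}: |\mathcal A(Q)|=1\}$ is the configuration space. It is a smooth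 $(n-3)$-dimensional submanifold of $\widetilde{\mathbf S}$, and $\mathcal P$ is regarded as a function on $\mathbf S$. A polygon $Q$ is *tangential* if there is a circle $\sigma$ (of positive radius) tangent to all the lines $e_i$ which lies either on the left of all the directed lines $\vec e_i$ or on the right of all of them. The *radius* $r$ of the inscribed circle $\sigma$ is its usual radius taken with the sign $+$ in the first case and with the sign $-$ in the second case. Let $\omega_Q$ be the winding number of $Q$ around the center of $\sigma$. Let $RT$ (respectively $LT$) be the number of pairs among $(\vec s_1,\vec s_2),\dots,(\vec s_{n-1},\vec s_n),(\vec s_n,\vec s_1)$ whose second direction is obtained from the first by a clockwise (respectively counterclockwise) turn by an angle smaller than $\pi$. Put $[\mathcal P(Q)>0]=1$ if $\mathcal P(Q)>0$ and $[\mathcal P(Q)>0]=0$ otherwise. The polygon $-Q$ is the image of $Q$ under the central symmetry $x\mapsto -x$. A *Morse point* is a nondegenerate critical point, and the *Morse index* $\mu_Q(\mathcal P)$ is the number of negative eigenvalues of the Hessian matrix of $\mathcal P$ at $Q$ in local coordinates on $\mathbf S$. **Theorem.** Let $Q\in\mathbf S$ be a tangential polygon with inscribed circle $\sigma$ of radius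 $r$. 1. If $r>0$, then $Q$ is a Morse point of $\mathcal P$ on $\mathbf S$, and $$\mu_Q(\mathcal P)=RT-1+2\omega_Q-[\mathcal P(Q)>0].$$ 2. If $r<0$, then $Q$ and $-Q$ are Morse points of $\mathcal P$ on $\mathbf S$, and $$\mu_Q(\mathcal P)=n-3-\mu_{-Q}(\mathcal P)=LT-1-2\omega_Q-[\mathcal P(Q)>0].$$ -/

import Mathlib

open scoped ContDiff

noncomputable section

namespace SlopePolygon

/-! The plane is `ℂ` with its standard orientation.  Indices in `Fin n` are cyclic: `i + 1` is the
successor of `i`, and the successor of the last index is `0`. -/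

/-- The oriented area `z.re * w.im - z.im * w.re` of the parallelogram spanned by `z` and `w`;
it is positive iff `w` points to the left of `z`. -/
def cross (z w : ℂ) : ℝ := z.re * w.im - z.im * w.re

/-- The oriented area of the closed broken line with vertices `v i`. -/
def area {n : ℕ} [NeZero n] (v : Fin n → ℂ) : ℝ :=
  (1 / 2) * ∑ i, cross (v i) (v (i + 1))

open Classical in
/-- The sign of the `i`-th edge, which goes from `v (i - 1)` to `v i`: it is `1` if the edge is
codirected with the direction `u i`, and `-1` otherwise. -/
def edgeSign {n : ℕ} [NeZero n] (u v : Fin n → ℂ) (i : Fin n) : ℝ :=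
  if ∃ t : ℝ, 0 < t ∧ v i - v (i - 1) = t • u i then 1 else -1

/-- The oriented perimeter of the closed broken line with vertices `v i`, with respect to the
directions `u i` of its edges. -/
def perimeter {n : ℕ} [NeZero n] (u v : Fin n → ℂ) : ℝ :=
  ∑ i, edgeSign u v i * dist (v (i - 1)) (v i)

/-- The polygons with edge slopes `u i`.  A polygon is given by its vertices; the vertices
`v (i - 1)` and `v i` lie on a common line `e i` of direction `u i`.  So `v i` is the intersection
point of `e i` and `e (i + 1)` if consecutive directions are not parallel. -/
def Polygons {n : ℕ} [NeZero n] (u : Fin n → ℂ) : Submodule ℝ (Fin n → ℂ) where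
  carrier := {v | ∀ i, v i - v (i - 1) ∈ Submodule.span ℝ {u i}}
  zero_mem' := fun i => by simp
  add_mem' := by
    intro v w hv hw i
    have h := Submodule.add_mem _ (hv i) (hw i)
    have e : (v + w) i - (v + w) (i - 1) = (v i - v (i - 1)) + (w i - w (i - 1)) := by
      simp only [Pi.add_apply]; ring
    rw [e]; exact h
  smul_mem' := by
    intro c v hv i
    have h := Submodule.smul_mem _ c (hv i)
    have e : (c • v) i - (c • v) (i - 1) = c • (v i - v (i - 1)) := by
      simp only [Pi.smul_apply, smul_sub]
    rw [e]; exact h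

/-- The polygons all of whose vertices coincide: adding one of them is a translation. -/
def Translations {n : ℕ} [NeZero n] (u : Fin n → ℂ) : Submodule ℝ (Polygons u) where
  carrier := {v | ∃ c : ℂ, ∀ i, (v : Fin n → ℂ) i = c}
  zero_mem' := ⟨0, fun i => by simp⟩
  add_mem' := by
    rintro v w ⟨c, hc⟩ ⟨d, hd⟩
    exact ⟨c + d, fun i => by simp [hc i, hd i]⟩
  smul_mem' := by
    rintro a v ⟨c, hc⟩
    exact ⟨a • c, fun i => by simp [hc i]⟩

instance isClosed_translations {n : ℕ} [NeZero n] (u : Fin n → ℂ) :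
    IsClosed (Translations u : Set (Polygons u)) :=
  Submodule.closed_of_finiteDimensional _

/-- The space of polygons with edge slopes `u i` modulo translations. -/
abbrev PolygonSpace {n : ℕ} [NeZero n] (u : Fin n → ℂ) : Type :=
  Polygons u ⧸ Translations u

theorem cross_translate (c z w : ℂ) :
    cross (z + c) (w + c) = cross z w + (cross z c - cross w c) := by
  simp only [cross, Complex.add_re, Complex.add_im]; ring

theorem area_translate {n : ℕ} [NeZero n] (v : Fin n → ℂ) (c : ℂ) :
    area (fun i => v i + c) = area v := by
  have h : ∑ i, cross (v (i + 1)) c = ∑ i, cross (v i) c :=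
    Equiv.sum_comp (Equiv.addRight (1 : Fin n)) (fun i => cross (v i) c)
  simp only [area, cross_translate, Finset.sum_add_distrib, Finset.sum_sub_distrib, h]
  ring

theorem perimeter_translate {n : ℕ} [NeZero n] (u v : Fin n → ℂ) (c : ℂ) :
    perimeter u (fun i => v i + c) = perimeter u v := by
  have h : ∀ i, v i + c - (v (i - 1) + c) = v i - v (i - 1) := fun i => by ring
  have hs : ∀ i, edgeSign u (fun j => v j + c) i = edgeSign u v i := fun i => by
    unfold edgeSign
    classical
    exact if_congr (by rw [h i]) rfl rfl
  simp only [perimeter, hs, dist_add_right]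

theorem eq_translate {n : ℕ} [NeZero n] {u : Fin n → ℂ} {v w : Polygons u}
    (h : (Translations u).quotientRel v w) :
    ∃ c : ℂ, (v : Fin n → ℂ) = fun i => (w : Fin n → ℂ) i + c := by
  rw [Submodule.quotientRel_def] at h
  obtain ⟨c, hc⟩ := h
  refine ⟨c, funext fun i => ?_⟩
  have := hc i
  simp only [Submodule.coe_sub, Pi.sub_apply] at this
  rw [← this]; ring

/-- The oriented area as a function on the space of polygons modulo translations. -/
def areaMod {n : ℕ} [NeZero n] (u : Fin n → ℂ) : PolygonSpace u → ℝ :=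
  Quotient.lift (s := (Translations u).quotientRel) (fun v => area (v : Fin n → ℂ)) (by
    intro v w h
    obtain ⟨c, hc⟩ := eq_translate h
    simp only [hc, area_translate])

/-- The oriented perimeter as a function on the space of polygons modulo translations. -/
def perimeterMod {n : ℕ} [NeZero n] (u : Fin n → ℂ) : PolygonSpace u → ℝ :=
  Quotient.lift (s := (Translations u).quotientRel) (fun v => perimeter u (v : Fin n → ℂ)) (by
    intro v w h
    obtain ⟨c, hc⟩ := eq_translate h
    simp only [hc, perimeter_translate])

/-- The configuration space of polygons with edge slopes `u i`: the polygons modulo translations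
whose oriented area has absolute value `1`. -/
def configurationSpace {n : ℕ} [NeZero n] (u : Fin n → ℂ) : Set (PolygonSpace u) :=
  {q | |areaMod u q| = 1}

theorem area_neg {n : ℕ} [NeZero n] (v : Fin n → ℂ) : area (-v) = area v := by
  simp [area, cross]

theorem neg_mem_configurationSpace {n : ℕ} [NeZero n] {u : Fin n → ℂ} {Q : Polygons u}
    (hQ : Submodule.Quotient.mk Q ∈ configurationSpace u) :
    Submodule.Quotient.mk (-Q) ∈ configurationSpace u := by
  have h : |area (Q : Fin n → ℂ)| = 1 := hQ
  change |area ((-Q : Polygons u) : Fin n → ℂ)| = 1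
  rw [Submodule.coe_neg, area_neg, h]

/-- The line `e i` of a polygon: the line of direction `u i` through the vertex `v i`. -/
def edgeLine {n : ℕ} (u v : Fin n → ℂ) (i : Fin n) : Set ℂ :=
  {z | ∃ t : ℝ, z = v i + t • u i}

/-- The circle with centre `O` and signed radius `r ≠ 0` is inscribed in the polygon `v` with edge
directions `u i`: it is tangent to all the lines `e i` (it meets each of them in exactly one point),
and it lies on the left of all the directed lines `e i` if `r > 0`, on the right of all of them if
`r < 0`. -/
def IsInscribedCircle {n : ℕ} (u v : Fin n → ℂ) (O : ℂ) (r : ℝ) : Prop :=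
  r ≠ 0 ∧
  (∀ i, ∃! z, z ∈ edgeLine u v i ∧ z ∈ Metric.sphere O |r|) ∧
  (0 < r → ∀ i, ∀ z ∈ Metric.sphere O |r|, 0 ≤ cross (u i) (z - v i)) ∧
  (r < 0 → ∀ i, ∀ z ∈ Metric.sphere O |r|, cross (u i) (z - v i) ≤ 0)

/-- The winding number around `O` of the closed broken line with vertices `v i`: the sum of the
signed angles, in `(-π, π)` for a broken line that avoids `O`, under which the edges are seen
from `O`, divided by `2π`. -/
def windingNumber {n : ℕ} [NeZero n] (v : Fin n → ℂ) (O : ℂ) : ℝ :=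
  (∑ i, Complex.arg ((v (i + 1) - O) / (v i - O))) / (2 * Real.pi)

/-- The number of right turns: the number of cyclically consecutive pairs of directions such that
the signed angle from the first to the second is clockwise and smaller than `π`. -/
def rightTurns {n : ℕ} [NeZero n] (u : Fin n → ℂ) : ℕ :=
  Nat.card {i : Fin n // Complex.arg (u (i + 1) / u i) ∈ Set.Ioo (-Real.pi) 0}

/-- The number of left turns: the number of cyclically consecutive pairs of directions such that
the signed angle from the first to the second is counterclockwise and smaller than `π`. -/
def leftTurns {n : ℕ} [NeZero n] (u : Fin n → ℂ) : ℕ :=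
  Nat.card {i : Fin n // Complex.arg (u (i + 1) / u i) ∈ Set.Ioo 0 Real.pi}

/-! Morse theory of functions on a `d`-dimensional smooth submanifold `M` of a normed space. -/

section Morse

variable {E : Type*} [NormedAddCommGroup E] [NormedSpace ℝ E] {M : Set E}

/-- `φ` is a smooth local parametrization (inverse of a chart) of `M` that sends `x` to `p`: a
homeomorphism from an open neighbourhood of `x` in `ℝ^d` onto an open neighbourhood of `p` in `M`,
which is smooth and has injective derivatives as a map to the ambient space. -/
structure IsLocalParametrization {d : ℕ}
    (φ : OpenPartialHomeomorph (EuclideanSpace ℝ (Fin d)) M)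
    (x : EuclideanSpace ℝ (Fin d)) (p : M) : Prop where
  mem_source : x ∈ φ.source
  map_eq : φ x = p
  smooth : ContDiffOn ℝ ∞ (fun y => (φ y : E)) φ.source
  immersion : ∀ y ∈ φ.source, Function.Injective (fderiv ℝ (fun y => (φ y : E)) y)

/-- The Hessian matrix of second partial derivatives of `g` at `x`. -/
def hessianMatrix {d : ℕ} (g : EuclideanSpace ℝ (Fin d) → ℝ) (x : EuclideanSpace ℝ (Fin d)) :
    Matrix (Fin d) (Fin d) ℝ :=
  Matrix.of fun i j =>
    fderiv ℝ (fun y => fderiv ℝ g y (EuclideanSpace.single j 1)) x (EuclideanSpace.single i 1)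

open Classical in
/-- The number of negative eigenvalues of a matrix, counted with multiplicity. -/
def negativeEigenvalues {d : ℕ} (H : Matrix (Fin d) (Fin d) ℝ) : ℕ :=
  H.charpoly.roots.countP (fun a => a < 0)

/-- `p` is a Morse point (a nondegenerate critical point) of the function `f` on `M`, and `M` is a
`d`-dimensional smooth submanifold near `p`: there is a smooth local parametrization at `p`, and in
each of them `f` is smooth at `p`, its differential at `p` is zero and its Hessian matrix at `p`
is nondegenerate. -/
def IsMorsePoint (d : ℕ) (f : M → ℝ) (p : M) : Prop :=
  (∃ (φ : OpenPartialHomeomorph (EuclideanSpace ℝ (Fin d)) M) (x : EuclideanSpace ℝ (Fin d)),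
    IsLocalParametrization φ x p) ∧
  ∀ (φ : OpenPartialHomeomorph (EuclideanSpace ℝ (Fin d)) M) (x : EuclideanSpace ℝ (Fin d)),
    IsLocalParametrization φ x p →
      ContDiffAt ℝ ∞ (fun y => f (φ y)) x ∧
      fderiv ℝ (fun y => f (φ y)) x = 0 ∧
      (hessianMatrix (fun y => f (φ y)) x).det ≠ 0

/-- `μ` is the Morse index of `f` at the Morse point `p`: the number of negative eigenvalues of the
Hessian matrix in each smooth local parametrization at `p`. -/
def HasMorseIndex (d : ℕ) (f : M → ℝ) (p : M) (μ : ℕ) : Prop :=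
  IsMorsePoint d f p ∧
  ∀ (φ : OpenPartialHomeomorph (EuclideanSpace ℝ (Fin d)) M) (x : EuclideanSpace ℝ (Fin d)),
    IsLocalParametrization φ x p →
      negativeEigenvalues (hessianMatrix (fun y => f (φ y)) x) = μ

end Morse

/-- The oriented perimeter as a function on the configuration space. -/
def perimeterOnConfigurationSpace {n : ℕ} [NeZero n] (u : Fin n → ℂ) :
    configurationSpace u → ℝ :=
  fun q => perimeterMod u q

end SlopePolygon

end

namespace SlopePolygon

open Module

/-! ### Orthogonal bases of a real symmetric form -/

section Inertia

variable {V : Type*} [AddCommGroup V] [Module ℝ V] {ι ι' : Type*} [Fintype ι]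

/-! On the `(n - 2)`-dimensional space of polygons modulo translations the oriented area is a
nondegenerate quadratic form `B x x`, and the configuration space is the quadric `|B x x| = 1`. The
oriented perimeter is linear there. If `Q` has an inscribed circle of signed radius `r`, each edge
line of `Q` has signed distance `r` from the centre, so the mixed part of `area (Q + X)` is `r`
times the perimeter of `X` (`area_add_of_tangential`); hence the perimeter equals `(2 / r) * B Q X`.

It remains to study `a * B p x` near `p` on the quadric. Where `B x x = B p p`, it equals `a * B p p
- (a / 2) * B (x - p) (x - p)`. So `p` is critical with Hessian `-a * B` on the tangent space, the
orthogonal complement of `p`. For `a > 0` the index is the positive index of `B`, less one if `B p p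
> 0` (`exists_hasMorseIndex`); negative `r` is handled by passing to `-B` or to `-Q`.

The positive index comes from diagonalizing the area in the heights of the vertices above the first
edge (`area_eq_sum_sq`). Each coefficient has the sign of an oriented triple of directions, which is
a sum of three angle defects. These telescope around the cycle and leave the turns and the total
turning of the directions (`card_areaCoeff_pos`). For a tangential polygon the total turning divided
by `2π` is the winding number around the centre (`windingNumber_of_tangential`). -/

theorem bilin_sum_smul_self {κ : Type*} (B : LinearMap.BilinForm ℝ V) (s : Finset κ) (v : κ → V)
    (a : κ → ℝ) (hv : ∀ i j, i ≠ j → B (v i) (v j) = 0) :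
    B (∑ i ∈ s, a i • v i) (∑ i ∈ s, a i • v i) = ∑ i ∈ s, a i ^ 2 * B (v i) (v i) := by
  classical
  simp only [map_sum, LinearMap.sum_apply, map_smul, LinearMap.smul_apply, smul_eq_mul]
  refine Finset.sum_congr rfl fun i hi => ?_
  rw [Finset.sum_eq_single i]
  · ring
  · intro j _ hji
    rw [hv j i hji]; ring
  · exact fun h => absurd hi h

/-- A vector common to the span of the positive members of `b` and the span of the nonpositive
members of `b'` has square both `≥ 0` and `≤ 0`, so it vanishes; the dimensions of the two spans
then add up to at most that of `V`. -/
theorem card_pos_le_card_pos [Fintype ι'] (B : LinearMap.BilinForm ℝ V) (b : Basis ι ℝ V) (b' : Basis ι' ℝ V)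
    (hb : ∀ i j, i ≠ j → B (b i) (b j) = 0) (hb' : ∀ i j, i ≠ j → B (b' i) (b' j) = 0) :
    Nat.card {i // 0 < B (b i) (b i)} ≤ Nat.card {i // 0 < B (b' i) (b' i)} := by
  classical
  have := b.finiteDimensional_of_finite
  let p : {i // 0 < B (b i) (b i)} → V := fun i => b i
  let q : {i // ¬ 0 < B (b' i) (b' i)} → V := fun i => b' i
  have hp : LinearIndependent ℝ p := b.linearIndependent.comp _ Subtype.val_injective
  have hq : LinearIndependent ℝ q := b'.linearIndependent.comp _ Subtype.val_injective
  have hdisj : Disjoint (Submodule.span ℝ (Set.range p)) (Submodule.span ℝ (Set.range q)) := by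
    rw [Submodule.disjoint_def]
    intro x hx hx'
    obtain ⟨a, rfl⟩ := (Submodule.mem_span_range_iff_exists_fun ℝ).1 hx
    obtain ⟨a', ha'⟩ := (Submodule.mem_span_range_iff_exists_fun ℝ).1 hx'
    have h1 := bilin_sum_smul_self B Finset.univ p a
      (fun i j h => hb _ _ fun h' => h (Subtype.ext h'))
    have h2 := bilin_sum_smul_self B Finset.univ q a'
      (fun i j h => hb' _ _ fun h' => h (Subtype.ext h'))
    rw [ha', h1] at h2
    have h3 : ∑ i, a' i ^ 2 * B (q i) (q i) ≤ 0 :=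
      Finset.sum_nonpos fun i _ => mul_nonpos_of_nonneg_of_nonpos (sq_nonneg _) (not_lt.1 i.2)
    have h4 : ∀ i ∈ Finset.univ, 0 ≤ a i ^ 2 * B (p i) (p i) :=
      fun i _ => mul_nonneg (sq_nonneg _) i.2.le
    have h5 := (Finset.sum_eq_zero_iff_of_nonneg h4).1
      (le_antisymm (h2 ▸ h3) (Finset.sum_nonneg h4))
    refine Finset.sum_eq_zero fun i hi => ?_
    have h6 : a i = 0 := by simpa [i.2.ne'] using (mul_eq_zero.1 (h5 i hi)).resolve_right i.2.ne'
    rw [h6, zero_smul]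
  have hdim := Submodule.finrank_add_finrank_le_of_disjoint hdisj
  rw [finrank_span_eq_card hp, finrank_span_eq_card hq, finrank_eq_card_basis b',
    Fintype.card_subtype_compl] at hdim
  have := Fintype.card_subtype_le (fun i => 0 < B (b' i) (b' i))
  rw [Nat.card_eq_fintype_card, Nat.card_eq_fintype_card]
  omega

/-- **Sylvester's law of inertia**: the number of positive squares in an orthogonal basis does not
depend on the basis. -/
theorem card_pos_eq_card_pos [Fintype ι'] (B : LinearMap.BilinForm ℝ V) (b : Basis ι ℝ V) (b' : Basis ι' ℝ V)
    (hb : ∀ i j, i ≠ j → B (b i) (b j) = 0) (hb' : ∀ i j, i ≠ j → B (b' i) (b' j) = 0) :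
    Nat.card {i // 0 < B (b i) (b i)} = Nat.card {i // 0 < B (b' i) (b' i)} :=
  le_antisymm (card_pos_le_card_pos B b b' hb hb') (card_pos_le_card_pos B b' b hb' hb)

/-- A member of an orthogonal basis with zero square lies in the radical, which the basis `b` shows
to be trivial. -/
theorem bilin_self_ne_zero_of_orthogonal (B : LinearMap.BilinForm ℝ V) (b : Basis ι ℝ V)
    (b' : Basis ι' ℝ V) (hb : ∀ i j, i ≠ j → B (b i) (b j) = 0)
    (hb' : ∀ i j, i ≠ j → B (b' i) (b' j) = 0) (hne : ∀ i, B (b i) (b i) ≠ 0) (k : ι') :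
    B (b' k) (b' k) ≠ 0 := by
  classical
  intro hk
  have h0 : B (b' k) = 0 := b'.ext fun j => by
    by_cases h : k = j
    · rw [← h, hk]; rfl
    · exact hb' _ _ h
  have hr : b.repr (b' k) = 0 := by
    ext i
    have h1 : B (b' k) (b i) = b.repr (b' k) i * B (b i) (b i) := by
      conv_lhs => rw [← b.sum_repr (b' k)]
      simp only [map_sum, LinearMap.sum_apply, map_smul, LinearMap.smul_apply, smul_eq_mul]
      rw [Finset.sum_eq_single i (fun j _ h => by rw [hb j i h, mul_zero])
        (fun h => absurd (Finset.mem_univ i) h)]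
    rw [h0, LinearMap.zero_apply] at h1
    exact (mul_eq_zero.1 h1.symm).resolve_right (hne i)
  exact b'.ne_zero k (b.repr.map_eq_zero_iff.1 hr)

end Inertia

theorem negativeEigenvalues_eq_card {d : ℕ} {H : Matrix (Fin d) (Fin d) ℝ} (hH : H.IsHermitian) :
    negativeEigenvalues H = Nat.card {i // hH.eigenvalues i < 0} := by
  classical
  rw [negativeEigenvalues, hH.roots_charpoly_eq_eigenvalues, Multiset.countP_map,
    Nat.card_eq_fintype_card, Fintype.card_subtype]
  rfl

/-! ### The index of a form on an orthogonal complement -/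

section Quadric

variable {E : Type*} [NormedAddCommGroup E] [NormedSpace ℝ E]

open EuclideanSpace

/-- The index of a negative multiple of the form `B`, pulled back along an injective map `J` into
the orthogonal complement of `p`. -/
theorem index_of_hessian {d : ℕ} (B : LinearMap.BilinForm ℝ E) (hB : ∀ x y, B x y = B y x)
    {ι : Type*} [Fintype ι] (b : Basis ι ℝ E) (hb : ∀ i j, i ≠ j → B (b i) (b j) = 0)
    (hne : ∀ i, B (b i) (b i) ≠ 0) (hcard : Fintype.card ι = d + 1) {a : ℝ} (ha : 0 < a) {p : E}
    (hp : B p p ≠ 0) (J : EuclideanSpace ℝ (Fin d) →ₗ[ℝ] E) (hJ : Function.Injective J)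
    (hpJ : ∀ v, B p (J v) = 0) (H : Matrix (Fin d) (Fin d) ℝ)
    (hH : ∀ i j, H i j = -a * B (J (single i 1)) (J (single j 1))) :
    H.det ≠ 0 ∧
      negativeEigenvalues H + (if 0 < B p p then 1 else 0) = Nat.card {i // 0 < B (b i) (b i)} := by
  classical
  have hherm : H.IsHermitian := by
    ext i j
    simp [hH, hB (J (single i 1))]
  let w := hherm.eigenvectorBasis
  have hbil : ∀ x y : EuclideanSpace ℝ (Fin d),
      x.ofLp ⬝ᵥ (H.mulVec y.ofLp) = -a * B (J x) (J y) := by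
    intro x y
    have e : ∀ z : EuclideanSpace ℝ (Fin d), z = ∑ i, z i • single i (1 : ℝ) := fun z => by
      ext i
      simp [Finset.sum_apply, Pi.single_apply]
    conv_rhs => rw [e x, e y]
    simp only [map_sum, map_smul, LinearMap.sum_apply, LinearMap.smul_apply, smul_eq_mul,
      dotProduct, Matrix.mulVec, hH, Finset.mul_sum]
    rw [Finset.sum_comm]
    refine Finset.sum_congr rfl fun i _ => Finset.sum_congr rfl fun j _ => ?_
    ring
  have hw : ∀ j k, -a * B (J (w j)) (J (w k)) = if j = k then hherm.eigenvalues k else 0 := by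
    intro j k
    rw [← hbil, hherm.mulVec_eigenvectorBasis, dotProduct_smul]
    have h1 : (w j).ofLp ⬝ᵥ (w k).ofLp = inner ℝ (w k) (w j) := by
      simp [EuclideanSpace.inner_eq_star_dotProduct]
    have h2 := orthonormal_iff_ite.1 w.orthonormal k j
    change hherm.eigenvalues k • ((w j).ofLp ⬝ᵥ (w k).ofLp) = _
    rw [h1, h2]
    by_cases h : j = k
    · simp [h]
    · simp [h, Ne.symm h]
  -- The point `p` and the images of the eigenvectors form a `B`-orthogonal basis of `E`. By inertia
  -- its positive squares are as many as those of `b`; the one at `none` gives the correction by `B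
  -- p p`.
  let v : Option (Fin d) → E := fun o => o.elim p (fun j => J (w j))
  have hv : LinearIndependent ℝ v := by
    rw [linearIndependent_option]
    have h := w.toBasis.linearIndependent.map' J (LinearMap.ker_eq_bot.2 hJ)
    rw [w.coe_toBasis] at h
    refine ⟨h, ?_⟩
    intro hmem
    have hle : Submodule.span ℝ (Set.range (v ∘ ((↑) : Fin d → Option (Fin d)))) ≤
        LinearMap.ker (B p) := by
      rw [Submodule.span_le]
      rintro _ ⟨j, rfl⟩
      exact hpJ _
    exact hp (hle hmem)
  have hcard' : Fintype.card (Option (Fin d)) = finrank ℝ E := by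
    rw [finrank_eq_card_basis b, hcard]; simp
  let b' := basisOfLinearIndependentOfCardEqFinrank hv hcard'
  have hb'v : ∀ o, b' o = v o := fun o => by
    simp [b']
  have hb' : ∀ i j, i ≠ j → B (b' i) (b' j) = 0 := by
    intro i j hij
    rw [hb'v, hb'v]
    rcases i with _ | i <;> rcases j with _ | j
    · exact absurd rfl hij
    · exact hpJ _
    · change B (J _) p = 0
      rw [hB]; exact hpJ _
    · have h := hw i j
      rw [if_neg fun h => hij (by rw [h])] at h
      exact (mul_eq_zero.1 h).resolve_left (neg_ne_zero.2 ha.ne')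
  have hne' := bilin_self_ne_zero_of_orthogonal B b b' hb hb' hne
  have heig : ∀ j, hherm.eigenvalues j = -a * B (b' (some j)) (b' (some j)) := fun j => by
    have h := hw j j
    rw [if_pos rfl] at h
    rw [hb'v, ← h]; rfl
  constructor
  · rw [hherm.det_eq_prod_eigenvalues]
    refine Finset.prod_ne_zero_iff.2 fun j _ => ?_
    simp only [RCLike.ofReal_real_eq_id, id, heig]
    exact mul_ne_zero (neg_ne_zero.2 ha.ne') (hne' _)
  · rw [card_pos_eq_card_pos B b b' hb hb', negativeEigenvalues_eq_card hherm,
      Nat.card_eq_fintype_card, Nat.card_eq_fintype_card, Fintype.card_subtype,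
      Fintype.card_subtype, Finset.card_filter, Finset.card_filter, Fintype.sum_option, add_comm,
      hb'v none]
    congr 1
    refine Finset.sum_congr rfl fun j _ => if_congr ?_ rfl rfl
    rw [heig, neg_mul, neg_lt_zero, mul_pos_iff_of_pos_left ha]

end Quadric

end SlopePolygon

namespace SlopePolygon

open Module Topology

/-! ### Linear functions on the quadric `|B x x| = 1` -/

section Quadric

variable {E : Type*} [NormedAddCommGroup E] [NormedSpace ℝ E]

open EuclideanSpace

/-- Rewriting `f` through `B (ψ y - p) (ψ y - p)`, which vanishes to second order at `x`, keeps the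
second derivatives of `ψ` out of the Hessian. This gives the Hessian in every parametrization at
once. -/
theorem parametrization_derivatives {d : ℕ} {M : Set E} (B : E →L[ℝ] E →L[ℝ] ℝ)
    (hB : ∀ x y, B x y = B y x) (hM : ∀ x ∈ M, |B x x| = 1) {a : ℝ} {p : M} (f : M → ℝ)
    (hf : ∀ m : M, f m = a * B p m)
    (φ : OpenPartialHomeomorph (EuclideanSpace ℝ (Fin d)) M) (x : EuclideanSpace ℝ (Fin d))
    (hφ : IsLocalParametrization φ x p) :
    ContDiffAt ℝ ∞ (fun y => f (φ y)) x ∧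
    fderiv ℝ (fun y => f (φ y)) x = 0 ∧
    ∃ J : EuclideanSpace ℝ (Fin d) →ₗ[ℝ] E, Function.Injective J ∧ (∀ v, B p (J v) = 0) ∧
      ∀ i j, hessianMatrix (fun y => f (φ y)) x i j =
        -a * B (J (single i 1)) (J (single j 1)) := by
  set ψ : EuclideanSpace ℝ (Fin d) → E := fun y => (φ y : E) with hψ
  have hs : φ.source ∈ 𝓝 x := φ.open_source.mem_nhds hφ.mem_source
  have hψs : ∀ y ∈ φ.source, ContDiffAt ℝ ∞ ψ y := fun y hy =>
    hφ.smooth.contDiffAt (φ.open_source.mem_nhds hy)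
  have hψx : ψ x = p := by simp only [hψ, hφ.map_eq]
  have hd : ∀ y ∈ φ.source, HasFDerivAt ψ (fderiv ℝ ψ y) y := fun y hy =>
    ((hψs y hy).differentiableAt (by simp)).hasFDerivAt
  have hfψ : (fun y => f (φ y)) = fun y => a * B p (ψ y) := funext fun y => hf _
  -- the form is constant along the parametrization
  have hconst : ∀ᶠ y in 𝓝 x, B (ψ y) (ψ y) = B p p := by
    -- On `M` the form takes only the values `1` and `-1`; positivity of the product with `B p p` is
    -- an open condition that fixes which one.
    have hc : ContinuousAt (fun y => B (ψ y) (ψ y) * B p p) x := by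
      have := (hψs x hφ.mem_source).continuousAt
      fun_prop
    have hp1 := hM p p.2
    have hpos : 0 < B (ψ x) (ψ x) * B p p := by
      rw [hψx, ← abs_mul_abs_self, hp1]; norm_num
    filter_upwards [hc.eventually (lt_mem_nhds hpos)] with y hy
    have hy1 := hM (ψ y) (φ y).2
    rcases eq_or_eq_neg_of_abs_eq hp1 with h1 | h1 <;>
      rcases eq_or_eq_neg_of_abs_eq hy1 with h2 | h2 <;> rw [h1, h2] at hy ⊢ <;> norm_num at hy
  have heq : (fun y => f (φ y)) =ᶠ[𝓝 x]
      fun y => a * B p p - a / 2 * B (ψ y - p) (ψ y - p) := by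
    filter_upwards [hconst] with y hy
    rw [hf]
    change a * B p (ψ y) = _
    simp only [map_sub, sub_apply, hy, hB (ψ y) p]
    ring
  have hder : ∀ y ∈ φ.source, HasFDerivAt
      (fun y => a * B p p - a / 2 * B (ψ y - p) (ψ y - p))
      (-a • (B (ψ y - p)).comp (fderiv ℝ ψ y)) y := by
    intro y hy
    have h1 := (hd y hy).sub_const (p : E)
    have h2 := ((B.hasFDerivAt_of_bilinear h1 h1).const_mul (a / 2)).const_sub (a * B p p)
    refine h2.congr_fderiv ?_
    ext v
    simp [hB (fderiv ℝ ψ y v)]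
    ring
  have hfd : ∀ᶠ y in 𝓝 x, fderiv ℝ (fun y => f (φ y)) y =
      -a • (B (ψ y - p)).comp (fderiv ℝ ψ y) := by
    filter_upwards [heq.eventuallyEq_nhds, hs] with y hy hys
    rw [hy.fderiv_eq, (hder y hys).fderiv]
  refine ⟨?_, ?_, fderiv ℝ ψ x, hφ.immersion x hφ.mem_source, fun v => ?_, fun i j => ?_⟩
  · rw [hfψ]
    exact contDiffAt_const.mul ((B p).contDiff.contDiffAt.comp x (hψs x hφ.mem_source))
  · rw [hfd.self_of_nhds, hψx]
    ext v; simp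
  -- Differentiating the locally constant `B (ψ y) (ψ y)` shows that tangent vectors are orthogonal
  -- to `p`.
  · have h1 := (B.hasFDerivAt_of_bilinear (hd x hφ.mem_source) (hd x hφ.mem_source))
    have h2 := h1.unique ((hasFDerivAt_const (B p p) x).congr_of_eventuallyEq hconst)
    have h3 := DFunLike.congr_fun h2 v
    simp [hψx, hB (fderiv ℝ ψ x v)] at h3
    exact h3
  · have h1 : (fun y => fderiv ℝ (fun y => f (φ y)) y (single j 1)) =ᶠ[𝓝 x]
        fun y => -a * B (ψ y - p) (fderiv ℝ ψ y (single j 1)) := by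
      filter_upwards [hfd] with y hy
      rw [hy]; simp
    have h2 : DifferentiableAt ℝ (fun y => fderiv ℝ ψ y (single j 1)) x := by
      have : ContDiffAt ℝ ∞ (fderiv ℝ ψ) x :=
        (hψs x hφ.mem_source).fderiv_right (by simp)
      exact (this.differentiableAt (by simp)).clm_apply (differentiableAt_const _)
    have h3 := (B.hasFDerivAt_of_bilinear ((hd x hφ.mem_source).sub_const (p : E))
      h2.hasFDerivAt).const_mul (-a)
    simp only [hessianMatrix, Matrix.of_apply]
    rw [h1.fderiv_eq, h3.fderiv]
    simp [hψx]

/-- The chart of the quadric `|B x x| = 1` at `p` by radial projection from the tangent space. -/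
theorem exists_localParametrization {d : ℕ} {M : Set E} [FiniteDimensional ℝ E]
    (B : E →L[ℝ] E →L[ℝ] ℝ)
    (hM : ∀ x, x ∈ M ↔ |B x x| = 1)
    (hd : finrank ℝ E = d + 1) (p : M) :
    ∃ (φ : OpenPartialHomeomorph (EuclideanSpace ℝ (Fin d)) M) (x : EuclideanSpace ℝ (Fin d)),
      IsLocalParametrization φ x p := by
  classical
  -- The sign `c = ±1` normalizes the form to `c * B`, which is `1` at `p`, so that both signs of
  -- the area are treated together.
  set c : ℝ := B p p with hc
  have hc1 : |c| = 1 := (hM p).1 p.2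
  have hcc : c * c = 1 := by rw [← abs_mul_abs_self, hc1]; norm_num
  have hc0 : c ≠ 0 := fun h => by simp [h] at hcc
  -- a linear parametrization of the tangent space, and a left inverse of it
  have hker : finrank ℝ (LinearMap.ker (B p : E →ₗ[ℝ] ℝ)) = d := by
    have h1 := (B p : E →ₗ[ℝ] ℝ).finrank_range_add_finrank_ker
    have h2 : LinearMap.range (B p : E →ₗ[ℝ] ℝ) = ⊤ :=
      LinearMap.range_eq_top.2 (LinearMap.surjective fun h => hc0 (DFunLike.congr_fun h (p : E)))
    rw [h2, finrank_top, finrank_self, hd] at h1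
    omega
  let e : EuclideanSpace ℝ (Fin d) ≃ₗ[ℝ] LinearMap.ker (B p : E →ₗ[ℝ] ℝ) :=
    LinearEquiv.ofFinrankEq _ _ (by rw [hker]; simp)
  let J : EuclideanSpace ℝ (Fin d) →L[ℝ] E :=
    LinearMap.toContinuousLinearMap ((LinearMap.ker (B p : E →ₗ[ℝ] ℝ)).subtype ∘ₗ e.toLinearMap)
  have hJ : ∀ y, J y = e y := fun y => rfl
  have hpJ : ∀ y, B p (J y) = 0 := fun y => (e y).2
  obtain ⟨K0, hK0⟩ := LinearMap.exists_leftInverse_of_injective (J : _ →ₗ[ℝ] E)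
    (LinearMap.ker_eq_bot.2 fun y z h => e.injective (Subtype.ext h))
  let K : E →L[ℝ] EuclideanSpace ℝ (Fin d) := LinearMap.toContinuousLinearMap K0
  have hKJ : ∀ y, K (J y) = y := fun y => DFunLike.congr_fun hK0 y
  have hJK : ∀ z, B p z = 0 → J (K z) = z := fun z hz => by
    obtain ⟨y, hy⟩ := e.surjective ⟨z, hz⟩
    have : z = J y := by rw [hJ, hy]
    rw [this, hKJ]
  let N : EuclideanSpace ℝ (Fin d) → ℝ := fun y => c * B (p + J y) (p + J y)
  have hN : ContDiff ℝ ∞ N := by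
    have h1 : ContDiff ℝ ∞ fun y => (p : E) + J y := contDiff_const.add J.contDiff
    exact contDiff_const.mul ((B.contDiff.comp h1).clm_apply h1)
  let F : EuclideanSpace ℝ (Fin d) → E := fun y => (√(N y))⁻¹ • (p + J y)
  -- The inverse of the radial projection `F`: `m` is rescaled into the affine tangent space, where
  -- `B p` has the value `c`, and then read in the coordinates `K`.
  let G : E → EuclideanSpace ℝ (Fin d) := fun m => K ((c * B p m)⁻¹ • m - p)
  let S : Set (EuclideanSpace ℝ (Fin d)) := {y | 0 < N y}
  have hS : IsOpen S := isOpen_lt continuous_const hN.continuous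
  have hpF : ∀ y, c * B p (F y) = (√(N y))⁻¹ := fun y => by
    simp only [F, map_smul, map_add, hpJ, smul_eq_mul, add_zero, ← hc]
    linear_combination (√(N y))⁻¹ * hcc
  have hFF : ∀ y ∈ S, c * B (F y) (F y) = 1 := fun y hy => by
    have h1 : c * B (F y) (F y) = (√(N y))⁻¹ * (√(N y))⁻¹ * N y := by
      simp only [F, N, map_smul, smul_apply, smul_eq_mul]
      ring
    have h2 : √(N y) ≠ 0 := (Real.sqrt_pos.2 hy).ne'
    rw [h1]
    nth_rewrite 3 [← Real.mul_self_sqrt (le_of_lt hy)]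
    field_simp
  have hFM : ∀ y ∈ S, F y ∈ M := fun y hy => by
    have h1 := hFF y hy
    rw [hM, ← one_mul |_|, ← hc1, ← abs_mul, h1, hc1, abs_one]
  have hGF : ∀ y ∈ S, G (F y) = y := fun y hy => by
    have h2 : √(N y) ≠ 0 := (Real.sqrt_pos.2 hy).ne'
    simp only [G, hpF, inv_inv]
    simp only [F, smul_smul, mul_inv_cancel₀ h2, one_smul, add_sub_cancel_left, hKJ]
  have hFsm : ContDiffOn ℝ ∞ F S := fun y hy => by
    have h1 : ContDiffAt ℝ ∞ (fun y => (p : E) + J y) y :=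
      (contDiff_const.add J.contDiff).contDiffAt
    have h2 : ContDiffAt ℝ ∞ (fun y => √(N y)) y := hN.contDiffAt.sqrt (ne_of_gt hy)
    exact ((h2.inv (Real.sqrt_pos.2 hy).ne').smul h1).contDiffWithinAt
  -- The second inequality excludes the part of `M` where the form has the sign opposite to its sign
  -- at `p`.
  let T : Set M := {m | 0 < c * B p m ∧ 0 < c * B (m : E) m}
  have hT : IsOpen T :=
    (isOpen_lt continuous_const (by fun_prop : Continuous fun m : M => c * B p m)).inter
      (isOpen_lt continuous_const (by fun_prop : Continuous fun m : M => c * B (m : E) m))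
  have hTc : ∀ m ∈ T, c * B (m : E) m = 1 := fun m hm => by
    have := (hM m).1 m.2
    rw [← abs_of_pos hm.2, abs_mul, this, hc1, one_mul]
  have hJG : ∀ m : M, m ∈ T → (p : E) + J (G m) = (c * B p m)⁻¹ • (m : E) := fun m hm => by
    have h0 : B p ((c * B p m)⁻¹ • (m : E) - p) = 0 := by
      have h1 := hm.1.ne'
      have h2 : B p (m : E) ≠ 0 := right_ne_zero_of_mul h1
      rw [map_sub, map_smul, smul_eq_mul, ← hc]
      field_simp
      linear_combination -hcc
    simp only [G]
    rw [hJK _ h0]; abel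
  have hNG : ∀ m : M, m ∈ T → N (G m) = (c * B p m)⁻¹ * (c * B p m)⁻¹ := fun m hm => by
    simp only [N]
    rw [hJG m hm]
    simp only [map_smul, smul_apply, smul_eq_mul]
    linear_combination (c * B p m)⁻¹ * (c * B p m)⁻¹ * hTc m hm
  have hGS : ∀ m : M, m ∈ T → G m ∈ S := fun m hm => by
    change 0 < N (G m)
    rw [hNG m hm]
    have := hm.1
    positivity
  have hFG : ∀ m : M, m ∈ T → F (G m) = m := fun m hm => by
    simp only [F]
    rw [hJG m hm, hNG m hm, Real.sqrt_mul_self (inv_pos.2 hm.1).le, inv_inv, smul_smul,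
      mul_inv_cancel₀ hm.1.ne', one_smul]
  have hFp : ∀ y (hy : y ∈ S), (⟨F y, hFM y hy⟩ : M) ∈ T := fun y hy => by
    refine ⟨?_, ?_⟩
    · change 0 < c * B p (F y)
      rw [hpF]; exact inv_pos.2 (Real.sqrt_pos.2 hy)
    · change 0 < c * B (F y) (F y)
      rw [hFF y hy]; exact one_pos
  let Φ : EuclideanSpace ℝ (Fin d) → M := fun y => if h : y ∈ S then ⟨F y, hFM y h⟩ else p
  have hΦ : ∀ y (hy : y ∈ S), Φ y = ⟨F y, hFM y hy⟩ := fun y hy => dif_pos hy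
  have hΦF : Set.EqOn (fun y => (Φ y : E)) F S := fun y hy => by
    simp only [hΦ y hy]
  let φ : OpenPartialHomeomorph (EuclideanSpace ℝ (Fin d)) M :=
    { toFun := Φ
      invFun := fun m => G m
      source := S
      target := T
      map_source' := fun y hy => by rw [hΦ y hy]; exact hFp y hy
      map_target' := fun m hm => hGS m hm
      left_inv' := fun y hy => by rw [hΦ y hy]; exact hGF y hy
      right_inv' := fun m hm => by rw [hΦ _ (hGS m hm)]; exact Subtype.ext (hFG m hm)
      open_source := hS
      open_target := hT
      continuousOn_toFun := by
        rw [Topology.IsInducing.subtypeVal.continuousOn_iff]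
        exact hFsm.continuousOn.congr hΦF
      continuousOn_invFun := fun m hm => by
        have h1 := hm.1.ne'
        refine ContinuousAt.continuousWithinAt ?_
        refine K.continuous.continuousAt.comp ?_
        refine ContinuousAt.sub (ContinuousAt.smul (ContinuousAt.inv₀ ?_ h1) ?_) ?_ <;> fun_prop }
  have hS0 : (0 : EuclideanSpace ℝ (Fin d)) ∈ S := by
    change 0 < c * B (p + J 0) (p + J 0)
    rw [map_zero, add_zero, ← hc, hcc]; exact one_pos
  refine ⟨φ, 0, hS0, ?_, hFsm.congr hΦF, fun y hy => ?_⟩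
  · change Φ 0 = p
    rw [hΦ 0 hS0]
    apply Subtype.ext
    simp only [F, N, map_zero, add_zero, ← hc, hcc, Real.sqrt_one, inv_one, one_smul]
  · have hy' : y ∈ S := hy
    have hnhds : S ∈ 𝓝 y := hS.mem_nhds hy'
    have h1 : (fun y => (φ y : E)) =ᶠ[𝓝 y] F := Filter.eventuallyEq_of_mem hnhds hΦF
    rw [h1.fderiv_eq]
    have h2 : HasFDerivAt F (fderiv ℝ F y) y :=
      ((hFsm.contDiffAt hnhds).differentiableAt (by simp)).hasFDerivAt
    have h3 : DifferentiableAt ℝ G (F y) := by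
      have h4 : c * B p (F y) ≠ 0 := by
        rw [hpF]; exact inv_ne_zero (Real.sqrt_pos.2 hy').ne'
      refine K.differentiableAt.comp _ ?_
      refine DifferentiableAt.sub (DifferentiableAt.smul (DifferentiableAt.inv ?_ h4) ?_) ?_ <;>
        fun_prop
    -- The derivative of `F` is injective because `G ∘ F` is the identity near `y`.
    have h5 := h3.hasFDerivAt.comp y h2
    have h6 : HasFDerivAt (G ∘ F) (ContinuousLinearMap.id ℝ _) y :=
      (hasFDerivAt_id y).congr_of_eventuallyEq (Filter.eventuallyEq_of_mem hnhds hGF)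
    have h7 := h5.unique h6
    exact Function.LeftInverse.injective (g := fderiv ℝ G (F y))
      fun v => DFunLike.congr_fun h7 v

/-- A linear function proportional to `B p` with a positive factor, restricted to the quadric
`|B x x| = 1`, has a Morse point at `p`; its index is the positive index of `B`, diminished by one
if `B` is positive at `p`. -/
theorem exists_hasMorseIndex {d : ℕ} {M : Set E} (B : E →L[ℝ] E →L[ℝ] ℝ)
    (hB : ∀ x y, B x y = B y x) (hM : ∀ x, x ∈ M ↔ |B x x| = 1)
    {ι : Type*} [Fintype ι] (b : Basis ι ℝ E) (hb : ∀ i j, i ≠ j → B (b i) (b j) = 0)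
    (hne : ∀ i, B (b i) (b i) ≠ 0) (hcard : Fintype.card ι = d + 1) {a : ℝ} (ha : 0 < a) (p : M)
    (f : M → ℝ) (hf : ∀ m : M, f m = a * B p m) :
    ∃ μ : ℕ, HasMorseIndex d f p μ ∧
      μ + (if 0 < B p p then 1 else 0) = Nat.card {i // 0 < B (b i) (b i)} := by
  have := b.finiteDimensional_of_finite
  have hp : B p p ≠ 0 := fun h => by
    have := (hM p).1 p.2
    rw [h, abs_zero] at this
    exact zero_ne_one this
  have hφ := exists_localParametrization B hM (by rw [finrank_eq_card_basis b, hcard]) p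
  have key : ∀ (φ : OpenPartialHomeomorph (EuclideanSpace ℝ (Fin d)) M)
      (x : EuclideanSpace ℝ (Fin d)), IsLocalParametrization φ x p →
      (ContDiffAt ℝ ∞ (fun y => f (φ y)) x ∧ fderiv ℝ (fun y => f (φ y)) x = 0 ∧
        (hessianMatrix (fun y => f (φ y)) x).det ≠ 0) ∧
      negativeEigenvalues (hessianMatrix (fun y => f (φ y)) x) + (if 0 < B p p then 1 else 0) =
        Nat.card {i // 0 < B (b i) (b i)} := by
    intro φ x h
    obtain ⟨h1, h2, J, hJ, hpJ, hH⟩ :=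
      parametrization_derivatives B hB (fun x hx => (hM x).1 hx) f hf φ x h
    obtain ⟨h3, h4⟩ := index_of_hessian B.toLinearMap₁₂ hB b hb hne hcard ha hp J hJ hpJ _ hH
    exact ⟨⟨h1, h2, h3⟩, h4⟩
  obtain ⟨φ, x, h⟩ := hφ
  refine ⟨_, ⟨⟨⟨φ, x, h⟩, fun φ' x' h' => (key φ' x' h').1⟩, fun φ' x' h' => ?_⟩,
    (key φ x h).2⟩
  exact Nat.add_right_cancel ((key φ' x' h').2.trans (key φ x h).2.symm)

end Quadric

end SlopePolygon

namespace SlopePolygon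

open Module
open scoped Fin.CommRing

/-! ### Algebra of the area pairing -/

theorem cross_add_left (x y z : ℂ) : cross (x + y) z = cross x z + cross y z := by
  simp only [cross, Complex.add_re, Complex.add_im]; ring

theorem cross_add_right (x y z : ℂ) : cross x (y + z) = cross x y + cross x z := by
  simp only [cross, Complex.add_re, Complex.add_im]; ring

theorem cross_sub_right (x y z : ℂ) : cross x (y - z) = cross x y - cross x z := by
  simp only [cross, Complex.sub_re, Complex.sub_im]; ring

theorem cross_smul_right (t : ℝ) (x y : ℂ) : cross x (t • y) = t * cross x y := by
  simp only [cross, Complex.smul_re, Complex.smul_im, smul_eq_mul]; ring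

theorem cross_self (x : ℂ) : cross x x = 0 := by
  simp only [cross]; ring

theorem cross_comm (x y : ℂ) : cross x y = -cross y x := by
  simp only [cross]; ring

theorem cross_zero_right (x : ℂ) : cross x 0 = 0 := by simp [cross]

theorem exists_smul_of_cross_eq_zero {x y : ℂ} (hx : x ≠ 0) (h : cross x y = 0) :
    ∃ t : ℝ, y = t • x := by
  have hN : x.re ^ 2 + x.im ^ 2 ≠ 0 := fun h0 => hx (by
    apply Complex.ext <;> simp only [Complex.zero_re, Complex.zero_im] <;> nlinarith)
  refine ⟨(x.re * y.re + x.im * y.im) / (x.re ^ 2 + x.im ^ 2), ?_⟩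
  simp only [cross] at h
  apply Complex.ext <;> simp only [Complex.smul_re, Complex.smul_im, smul_eq_mul] <;> field_simp
  · linear_combination -x.im * h
  · linear_combination x.re * h

/-! ### The area form in heights, and its polarization at a tangential polygon -/

section Edges

variable {n : ℕ} [NeZero n] {u : Fin n → ℂ}

theorem exists_edge_eq_smul (v : Polygons u) (i : Fin n) :
    ∃ t : ℝ, (v : Fin n → ℂ) i - (v : Fin n → ℂ) (i - 1) = t • u i := by
  obtain ⟨t, ht⟩ := Submodule.mem_span_singleton.1 (v.2 i)
  exact ⟨t, ht.symm⟩

/-- The coefficients of the area form in the coordinates given by the heights of the vertices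
above the first edge. -/
noncomputable def areaCoeff {m : ℕ} (u : Fin (m + 2) → ℂ) (j : ℕ) : ℝ :=
  -cross (u ((j + 1 : ℕ))) (u ((j + 2 : ℕ))) /
    (2 * (cross (u 0) (u ((j + 1 : ℕ))) * cross (u 0) (u ((j + 2 : ℕ)))))

/-- Summation by parts. -/
theorem sum_range_mul_sub_sq (M h : ℕ → ℝ) (h0 : h 0 = 0) (m : ℕ) :
    ∑ k ∈ Finset.range (m + 1), M (k + 1) * (h (k + 1) ^ 2 - h k ^ 2) =
      M (m + 1) * h (m + 1) ^ 2 +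
        ∑ j ∈ Finset.range m, (M (j + 1) - M (j + 2)) * h (j + 1) ^ 2 := by
  induction m with
  | zero => simp [h0]
  | succ m ih =>
    rw [Finset.sum_range_succ, ih, Finset.sum_range_succ _ m]
    ring

theorem natCast_ne_zero_of_lt {m k : ℕ} (h0 : 0 < k) (hk : k < m + 2) :
    (k : Fin (m + 2)) ≠ 0 := by
  intro h
  have := congrArg Fin.val h
  rw [Fin.val_cast_of_lt hk] at this
  simp at this; omega

/-- In coordinates along and across `u 0`, the slope of an edge expresses its increment along `u 0`
through its height increment. Each area term thus becomes a telescoping difference plus a cotangent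
times a difference of squared heights; summation by parts makes the form diagonal. -/
theorem area_eq_sum_sq {m : ℕ} {u : Fin (m + 2) → ℂ} (hu : u 0 ≠ 0)
    (hpar : ∀ i, i ≠ 0 → cross (u 0) (u i) ≠ 0) (v : Polygons u) :
    area (v : Fin (m + 2) → ℂ) = ∑ j ∈ Finset.range m, areaCoeff u j *
      cross (u 0) ((v : Fin (m + 2) → ℂ) ((j + 1 : ℕ)) - (v : Fin (m + 2) → ℂ) 0) ^ 2 := by
  set w : ℕ → ℂ := fun k => (v : Fin (m + 2) → ℂ) k - (v : Fin (m + 2) → ℂ) 0 with hw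
  have hw0 : w 0 = 0 := by simp [hw]
  have hwn : w (m + 2) = 0 := by
    simp only [hw, Fin.natCast_self, sub_self]
  have hedge : ∀ k : ℕ, ∃ t : ℝ, w (k + 1) - w k = t • u ((k + 1 : ℕ)) := fun k => by
    obtain ⟨t, ht⟩ := exists_edge_eq_smul v ((k + 1 : ℕ))
    refine ⟨t, ?_⟩
    rw [← ht]
    simp [hw]
  have harea : area (v : Fin (m + 2) → ℂ) =
      (1 / 2) * ∑ k ∈ Finset.range (m + 2), cross (w k) (w (k + 1)) := by
    rw [← area_translate _ (-(v : Fin (m + 2) → ℂ) 0), area]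
    rw [← Fin.sum_univ_eq_sum_range (fun k => cross (w k) (w (k + 1)))]
    congr 1
    refine Finset.sum_congr rfl fun i _ => ?_
    simp [hw, sub_eq_add_neg]
  set N : ℝ := (u 0).re ^ 2 + (u 0).im ^ 2 with hN
  have hN0 : N ≠ 0 := fun h0 => hu (by
    apply Complex.ext <;> simp only [Complex.zero_re, Complex.zero_im] <;> nlinarith)
  set dot : ℂ → ℝ := fun z => (u 0).re * z.re + (u 0).im * z.im with hdot
  set M : ℕ → ℝ := fun k => dot (u k) / cross (u 0) (u k) with hM
  set h : ℕ → ℝ := fun k => cross (u 0) (w k) with hh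
  have hh0 : h 0 = 0 := by simp [hh, hw0, cross]
  -- The last vertex and vertex `0` both lie on the line of edge `0`, so only the heights `1, …, m`
  -- are free.
  have hhm : h (m + 1) = 0 := by
    obtain ⟨t, ht⟩ := hedge (m + 1)
    rw [hwn, show ((m + 1 + 1 : ℕ) : Fin (m + 2)) = 0 from Fin.natCast_self (m + 2), zero_sub] at ht
    have h1 : w (m + 1) = (-t) • u 0 := by rw [neg_smul, ← ht, neg_neg]
    simp only [hh, h1, cross_smul_right, cross_self, mul_zero]
  have hterm : ∀ k ∈ Finset.range (m + 1), N * cross (w k) (w (k + 1)) =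
      (dot (w (k + 1)) * h (k + 1) - dot (w k) * h k) -
        M (k + 1) * (h (k + 1) ^ 2 - h k ^ 2) := by
    intro k hk
    obtain ⟨t, ht⟩ := hedge k
    have hc := hpar _ (natCast_ne_zero_of_lt (m := m) k.succ_pos
      (by have := Finset.mem_range.1 hk; omega))
    have h1 : dot (w (k + 1)) - dot (w k) = t * dot (u ((k + 1 : ℕ))) := by
      have := congrArg dot ht
      simp only [hdot, Complex.sub_re, Complex.sub_im, Complex.smul_re, Complex.smul_im,
        smul_eq_mul] at this ⊢
      linear_combination this
    have h2 : h (k + 1) - h k = t * cross (u 0) (u ((k + 1 : ℕ))) := by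
      have := congrArg (cross (u 0)) ht
      rwa [cross_sub_right, cross_smul_right] at this
    have h3 : dot (w (k + 1)) - dot (w k) = M (k + 1) * (h (k + 1) - h k) := by
      rw [h1, h2]; simp only [hM]; field_simp
    have h4 : N * cross (w k) (w (k + 1)) = dot (w k) * h (k + 1) - dot (w (k + 1)) * h k := by
      simp only [hN, hdot, hh, cross]; ring
    rw [h4]
    linear_combination -(h (k + 1) + h k) * h3
  have hsum : N * ∑ k ∈ Finset.range (m + 2), cross (w k) (w (k + 1)) =
      ∑ j ∈ Finset.range m, (M (j + 2) - M (j + 1)) * h (j + 1) ^ 2 := by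
    rw [Finset.sum_range_succ, hwn, cross_zero_right, add_zero, Finset.mul_sum,
      Finset.sum_congr rfl hterm, Finset.sum_sub_distrib,
      Finset.sum_range_sub (fun k => dot (w k) * h k), sum_range_mul_sub_sq M h hh0 m, hhm, hh0]
    simp only [mul_zero, sub_zero, zero_sub, ne_eq, OfNat.ofNat_ne_zero, not_false_eq_true,
      zero_pow, zero_add]
    rw [← Finset.sum_neg_distrib]
    refine Finset.sum_congr rfl fun j _ => ?_
    ring
  rw [harea]
  apply mul_left_cancel₀ hN0
  rw [mul_left_comm, hsum, Finset.mul_sum, Finset.mul_sum]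
  refine Finset.sum_congr rfl fun j hj => ?_
  have hj' := Finset.mem_range.1 hj
  have hc1 := hpar _ (natCast_ne_zero_of_lt (m := m) (j.succ_pos) (by omega))
  have hc2 := hpar _ (natCast_ne_zero_of_lt (m := m) ((j + 1).succ_pos) (by omega))
  -- The subtraction formula for cotangents.
  have key : M (j + 2) - M (j + 1) = 2 * N * areaCoeff u j := by
    simp only [hM, areaCoeff]
    simp only [Nat.succ_eq_add_one, add_assoc, Nat.reduceAdd] at hc1 hc2
    field_simp
    simp only [hdot, hN, cross]
    ring
  rw [key]
  ring

/-- The heights of the vertices of a polygon above the first edge. -/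
def heights {m : ℕ} (u : Fin (m + 2) → ℂ) : Polygons u →ₗ[ℝ] (Fin m → ℝ) where
  toFun v j := cross (u 0) ((v : Fin (m + 2) → ℂ) ((j + 1 : ℕ)) - (v : Fin (m + 2) → ℂ) 0)
  map_add' v w := by
    funext j
    simp only [Submodule.coe_add, Pi.add_apply, ← cross_add_right]
    congr 1; ring
  map_smul' c v := by
    funext j
    simp only [Submodule.coe_smul, Pi.smul_apply, RingHom.id_apply, smul_eq_mul,
      ← cross_smul_right, smul_sub]

/-- An edge not parallel to `u 0` whose ends have equal height is degenerate; hence all vertices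
coincide. -/
theorem heights_eq_zero_iff {m : ℕ} {u : Fin (m + 2) → ℂ}
    (hpar : ∀ i, i ≠ 0 → cross (u 0) (u i) ≠ 0) (v : Polygons u) :
    heights u v = 0 ↔ v ∈ Translations u := by
  constructor
  · intro h
    have hh : ∀ k < m + 1, cross (u 0) ((v : Fin (m + 2) → ℂ) k - (v : Fin (m + 2) → ℂ) 0) = 0 := by
      intro k hk
      rcases k with _ | k
      · simp [cross]
      · exact congrFun h ⟨k, by omega⟩
    have hm : cross (u 0)
        ((v : Fin (m + 2) → ℂ) ((m + 1 : ℕ)) - (v : Fin (m + 2) → ℂ) 0) = 0 := by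
      obtain ⟨t, ht⟩ := exists_edge_eq_smul v 0
      have h1 : (0 : Fin (m + 2)) - 1 = ((m + 1 : ℕ) : Fin (m + 2)) := by
        rw [sub_eq_iff_eq_add]
        have := Fin.natCast_self (m + 2)
        rw [← this]; push_cast; ring
      rw [h1, ← neg_sub] at ht
      rw [← neg_neg (_ - _), ht, ← neg_smul, cross_smul_right, cross_self, mul_zero]
    have hh' : ∀ k < m + 2,
        cross (u 0) ((v : Fin (m + 2) → ℂ) k - (v : Fin (m + 2) → ℂ) 0) = 0 := fun k hk => by
      rcases Nat.lt_succ_iff_lt_or_eq.1 hk with h1 | h1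
      · exact hh k h1
      · rw [h1]; exact hm
    have hk : ∀ k < m + 2, (v : Fin (m + 2) → ℂ) k = (v : Fin (m + 2) → ℂ) 0 := by
      intro k
      induction k with
      | zero => intro _; simp
      | succ k ih =>
        intro hk
        have ih := ih (by omega)
        obtain ⟨t, ht⟩ := exists_edge_eq_smul v ((k + 1 : ℕ))
        have h1 : (((k + 1 : ℕ) : Fin (m + 2)) - 1) = k := by simp
        rw [h1, ih] at ht
        have h2 := hh' _ hk
        rw [ht, cross_smul_right] at h2
        have h3 := (mul_eq_zero.1 h2).resolve_right
          (hpar _ (natCast_ne_zero_of_lt k.succ_pos hk))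
        rw [h3, zero_smul] at ht
        exact sub_eq_zero.1 ht
    refine ⟨(v : Fin (m + 2) → ℂ) 0, fun i => ?_⟩
    have := hk i i.2
    rwa [Fin.cast_val_eq_self] at this
  · rintro ⟨c, hc⟩
    funext j
    simp [heights, hc, cross]

theorem heights_surjective {m : ℕ} {u : Fin (m + 2) → ℂ} (hu : u 0 ≠ 0)
    (hpar : ∀ i, i ≠ 0 → cross (u 0) (u i) ≠ 0) : Function.Surjective (heights u) := by
  intro h
  -- Height zero at `0` and at `m + 1` lets the broken line `V` close up along `u 0`; the shift by
  -- one is there because `h` is indexed from vertex `1`.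
  let H : ℕ → ℝ := fun k => if hk : 0 < k ∧ k < m + 1 then h ⟨k - 1, by omega⟩ else 0
  let V : ℕ → ℂ := fun k => ∑ j ∈ Finset.range k,
    ((H (j + 1) - H j) / cross (u 0) (u ((j + 1 : ℕ)))) • u ((j + 1 : ℕ))
  have hV0 : V 0 = 0 := by simp [V]
  have hVH : ∀ k < m + 2, cross (u 0) (V k) = H k := by
    intro k
    induction k with
    | zero => intro _; simp [hV0, cross, H]
    | succ k ih =>
      intro hk
      have ih := ih (by omega)
      have h1 := hpar _ (natCast_ne_zero_of_lt k.succ_pos hk)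
      have h2 : V (k + 1) =
          V k + ((H (k + 1) - H k) / cross (u 0) (u ((k + 1 : ℕ)))) • u ((k + 1 : ℕ)) :=
        Finset.sum_range_succ _ _
      rw [h2, cross_add_right, cross_smul_right, ih, div_mul_cancel₀ _ h1]
      ring
  have hmem : (fun i : Fin (m + 2) => V i) ∈ Polygons u := by
    intro i
    rw [Submodule.mem_span_singleton]
    by_cases hi : i = 0
    · subst hi
      have h1 : ((0 : Fin (m + 2)) - 1).val = m + 1 := by
        have : (0 : Fin (m + 2)) - 1 = Fin.last (m + 1) := by
          rw [sub_eq_iff_eq_add]; simp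
        rw [this]; rfl
      beta_reduce
      rw [h1, Fin.val_zero, hV0, zero_sub]
      have h2 : cross (u 0) (V (m + 1)) = 0 := by
        rw [hVH _ (by omega)]; simp [H]
      obtain ⟨t, ht⟩ := exists_smul_of_cross_eq_zero hu h2
      exact ⟨-t, by rw [ht, neg_smul]⟩
    · obtain ⟨j, rfl⟩ := Fin.exists_succ_eq_of_ne_zero hi
      have h1 : j.succ - 1 = j.castSucc := by
        rw [sub_eq_iff_eq_add, Fin.coeSucc_eq_succ]
      have h2 : ((j.val + 1 : ℕ) : Fin (m + 2)) = j.succ := by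
        apply Fin.ext
        rw [Fin.val_cast_of_lt (by omega)]; rfl
      refine ⟨(H (j + 1) - H j) / cross (u 0) (u ((j + 1 : ℕ))), ?_⟩
      rw [h1]
      simp only [Fin.val_succ, Fin.val_castSucc, V]
      rw [Finset.sum_range_succ, add_sub_cancel_left, h2]
  refine ⟨⟨_, hmem⟩, funext fun j => ?_⟩
  have hj : j.val + 1 < m + 2 := by omega
  change cross (u 0) (V (((j.val + 1 : ℕ) : Fin (m + 2)).val) - V ((0 : Fin (m + 2)).val)) = h j
  rw [Fin.val_cast_of_lt hj, Fin.val_zero, hV0, sub_zero, hVH _ hj]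
  simp [H]

/-- The area is a nondegenerate quadratic form, which is diagonal in suitable coordinates. -/
theorem exists_area_form {m : ℕ} {u : Fin (m + 2) → ℂ} (hu : u 0 ≠ 0)
    (hpar : ∀ i, i ≠ 0 → cross (u 0) (u i) ≠ 0) :
    ∃ (B : PolygonSpace u →L[ℝ] PolygonSpace u →L[ℝ] ℝ) (b : Basis (Fin m) ℝ (PolygonSpace u)),
      (∀ x y, B x y = B y x) ∧ (∀ x, areaMod u x = B x x) ∧
      (∀ i j, i ≠ j → B (b i) (b j) = 0) ∧ ∀ j, B (b j) (b j) = areaCoeff u j := by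
  have hker : LinearMap.ker (heights u) = Translations u :=
    Submodule.ext fun v => heights_eq_zero_iff hpar v
  let Φ : PolygonSpace u ≃ₗ[ℝ] (Fin m → ℝ) :=
    (Submodule.quotEquivOfEq _ _ hker.symm).trans
      ((heights u).quotKerEquivOfSurjective (heights_surjective hu hpar))
  have hΦ : ∀ v : Polygons u, Φ (Submodule.Quotient.mk v) = heights u v := fun v => rfl
  let ℓ : Fin m → PolygonSpace u →L[ℝ] ℝ := fun j =>
    LinearMap.toContinuousLinearMap ((LinearMap.proj j) ∘ₗ Φ.toLinearMap)
  have hℓ : ∀ j x, ℓ j x = Φ x j := fun j x => rfl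
  let B : PolygonSpace u →L[ℝ] PolygonSpace u →L[ℝ] ℝ :=
    ∑ j : Fin m, areaCoeff u j • (ℓ j).smulRight (ℓ j)
  have hB : ∀ x y, B x y = ∑ j : Fin m, areaCoeff u j * (Φ x j * Φ y j) := fun x y => by
    simp [B, hℓ]
  have hb : ∀ i, Φ (Basis.ofEquivFun Φ i) = Pi.single i 1 := fun i => by
    simp
  refine ⟨B, Basis.ofEquivFun Φ, fun x y => ?_, fun x => ?_, fun i j hij => ?_, fun j => ?_⟩
  · simp only [hB, mul_comm (Φ x _)]
  · obtain ⟨v, rfl⟩ := Submodule.Quotient.mk_surjective _ x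
    change area (v : Fin (m + 2) → ℂ) = _
    rw [area_eq_sum_sq hu hpar, hB, hΦ, ← Fin.sum_univ_eq_sum_range (fun j => areaCoeff u j *
      cross (u 0) ((v : Fin (m + 2) → ℂ) ((j + 1 : ℕ)) - (v : Fin (m + 2) → ℂ) 0) ^ 2)]
    refine Finset.sum_congr rfl fun j _ => ?_
    rw [sq]; rfl
  · rw [hB, hb, hb]
    refine Finset.sum_eq_zero fun k _ => ?_
    by_cases h : k = i
    · subst h; simp [hij]
    · simp [h]
  · rw [hB, hb]
    rw [Finset.sum_eq_single j (fun k _ h => by simp [h]) (by simp)]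
    simp

/-- The signed length is linear in the edge coefficient `t`. A degenerate edge has sign `-1` by
convention but contributes zero. -/
theorem edgeSign_mul_dist {v : Polygons u} {i : Fin n} (hu : u i ≠ 0) {t : ℝ}
    (ht : (v : Fin n → ℂ) i - (v : Fin n → ℂ) (i - 1) = t • u i) :
    edgeSign u v i * dist ((v : Fin n → ℂ) (i - 1)) ((v : Fin n → ℂ) i) = t * ‖u i‖ := by
  rw [dist_comm, dist_eq_norm, edgeSign, ht, norm_smul, Real.norm_eq_abs, ← mul_assoc]
  congr 1
  split_ifs with h
  · obtain ⟨s, hs, h⟩ := h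
    rw [smul_left_injective ℝ hu h, abs_of_pos hs, one_mul]
  · have : t ≤ 0 := not_lt.1 fun h' => h ⟨t, h', rfl⟩
    rw [abs_of_nonpos this]; ring

/-- Polarizing the area form at a polygon with an inscribed circle gives the perimeter. -/
theorem area_add_of_tangential {Q : Fin n → ℂ} {O : ℂ} {r : ℝ} (hu : ∀ i, u i ≠ 0)
    (h1 : ∀ i, cross (u i) (O - Q i) = r * ‖u i‖)
    (h2 : ∀ i, cross (u (i + 1)) (O - Q i) = r * ‖u (i + 1)‖) (X : Polygons u) :
    area (Q + (X : Fin n → ℂ)) = area Q + area (X : Fin n → ℂ) + r * perimeter u (X : Fin n → ℂ) := by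
  set x : Fin n → ℂ := (X : Fin n → ℂ) with hx
  -- With the centre moved to the origin, `q i` pairs with `u i` and with `u (i + 1)` to `r` times
  -- their norms, since both lines through it are tangent.
  set q : Fin n → ℂ := fun i => Q i + -O with hq
  have hedge : ∀ (i : Fin n) (w : ℂ), cross w (u i) = r * ‖u i‖ →
      cross w (x i - x (i - 1)) =
        r * (edgeSign u x i * dist (x (i - 1)) (x i)) := by
    intro i w hw
    obtain ⟨t, ht⟩ := exists_edge_eq_smul X i
    rw [hx, edgeSign_mul_dist (hu i) ht, ht, cross_smul_right, hw]
    ring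
  have hs1 : ∑ i, cross (q i) (x i - x (i - 1)) = r * perimeter u x := by
    rw [perimeter, Finset.mul_sum]
    refine Finset.sum_congr rfl fun i _ => hedge i _ ?_
    rw [← h1 i, cross_comm (u i)]
    simp only [hq, cross, Complex.add_re, Complex.add_im, Complex.sub_re, Complex.sub_im,
      Complex.neg_re, Complex.neg_im]
    ring
  have hs2 : ∑ i, cross (q i) (x (i + 1) - x i) = r * perimeter u x := by
    rw [perimeter, Finset.mul_sum, ← Equiv.sum_comp (Equiv.addRight (1 : Fin n))
      (fun i => r * (edgeSign u x i * dist (x (i - 1)) (x i)))]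
    refine Finset.sum_congr rfl fun i _ => ?_
    simp only [Equiv.coe_addRight]
    rw [← hedge (i + 1) (q i), add_sub_cancel_right]
    rw [← h2 i, cross_comm (u (i + 1))]
    simp only [hq, cross, Complex.add_re, Complex.add_im, Complex.sub_re, Complex.sub_im,
      Complex.neg_re, Complex.neg_im]
    ring
  have hs3 : ∑ i, cross (x (i - 1)) (q i) = ∑ i, cross (x i) (q (i + 1)) := by
    rw [← Equiv.sum_comp (Equiv.addRight (1 : Fin n))]
    refine Finset.sum_congr rfl fun i _ => ?_
    simp only [Equiv.coe_addRight, add_sub_cancel_right]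
  have hadd : area (q + x) = area q + area x + r * perimeter u x := by
    have e : ∀ i, cross ((q + x) i) ((q + x) (i + 1)) =
        cross (q i) (q (i + 1)) + cross (x i) (x (i + 1)) +
          (cross (q i) (x (i + 1)) + cross (x i) (q (i + 1))) := fun i => by
      simp only [Pi.add_apply, cross_add_left, cross_add_right]; ring
    -- After a cyclic shift the mixed terms at `q i` pair it with the two edges of `x` of indices
    -- `i` and `i + 1`, so the perimeter is counted twice.
    have e2 : ∑ i, (cross (q i) (x (i + 1)) + cross (x i) (q (i + 1))) =
        2 * (r * perimeter u x) := by
      rw [Finset.sum_add_distrib, ← hs3, ← Finset.sum_add_distrib, two_mul]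
      nth_rewrite 1 [← hs2]
      rw [← hs1, ← Finset.sum_add_distrib]
      refine Finset.sum_congr rfl fun i _ => ?_
      rw [cross_comm (x (i - 1)), cross_sub_right, cross_sub_right]
      ring
    simp only [area, e, Finset.sum_add_distrib] at e2 ⊢
    rw [e2]; ring
  have hq1 : area q = area Q := area_translate Q (-O)
  have hq2 : area (q + x) = area (Q + x) := by
    rw [← area_translate (Q + x) (-O)]
    congr 1
    funext i
    simp only [hq, Pi.add_apply]; ring
  rw [← hq1, ← hq2, hadd]

end Edges

end SlopePolygon

namespace SlopePolygon

open Real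
open scoped Fin.CommRing

/-! ### Oriented angles and their defects -/

theorem cross_eq_im (z w : ℂ) : cross z w = ((starRingEnd ℂ) z * w).im := by
  simp [cross]; ring

theorem abs_cross_le (z w : ℂ) : |cross z w| ≤ ‖z‖ * ‖w‖ := by
  rw [cross_eq_im]
  refine (Complex.abs_im_le_norm _).trans ?_
  rw [norm_mul, RCLike.norm_conj]

theorem cross_I_mul_self (z : ℂ) : cross z (Complex.I * z) = ‖z‖ ^ 2 := by
  rw [Complex.sq_norm, Complex.normSq_apply]
  simp [cross]

theorem cross_eq_norm_mul_sin {z w : ℂ} (hz : z ≠ 0) (hw : w ≠ 0) :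
    cross z w = ‖z‖ * ‖w‖ * sin (Complex.arg (w / z)) := by
  have hz' : ‖z‖ ≠ 0 := norm_ne_zero_iff.2 hz
  have h0 : ‖w‖ ≠ 0 := norm_ne_zero_iff.2 hw
  have h1 : cross z w = ‖z‖ ^ 2 * (w / z).im := by
    have h2 : w = z * (w / z) := by field_simp
    rw [Complex.sq_norm, Complex.normSq_apply]
    conv_lhs => rw [h2]
    simp only [cross, Complex.mul_re, Complex.mul_im]; ring
  rw [h1, Complex.sin_arg, norm_div]
  field_simp

theorem abs_arg_div_lt_pi {z w : ℂ} (h : cross z w ≠ 0) :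
    -π < Complex.arg (w / z) ∧ Complex.arg (w / z) < π ∧ Complex.arg (w / z) ≠ 0 := by
  have hz : z ≠ 0 := fun h0 => h (by simp [h0, cross])
  have hw : w ≠ 0 := fun h0 => h (by simp [h0, cross])
  rw [cross_eq_norm_mul_sin hz hw] at h
  refine ⟨Complex.neg_pi_lt_arg _, lt_of_le_of_ne (Complex.arg_le_pi _) fun h' => h ?_,
    fun h' => h ?_⟩ <;> simp [h']

theorem sign_cross {z w : ℂ} (h : cross z w ≠ 0) :
    Real.sign (cross z w) = Real.sign (Complex.arg (w / z)) := by
  have hz : z ≠ 0 := fun h0 => h (by simp [h0, cross])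
  have hw : w ≠ 0 := fun h0 => h (by simp [h0, cross])
  obtain ⟨h1, h2, h3⟩ := abs_arg_div_lt_pi h
  have hp : 0 < ‖z‖ * ‖w‖ := mul_pos (norm_pos_iff.2 hz) (norm_pos_iff.2 hw)
  rw [cross_eq_norm_mul_sin hz hw]
  rcases lt_or_gt_of_ne h3 with h4 | h4
  · rw [Real.sign_of_neg h4, Real.sign_of_neg]
    exact mul_neg_of_pos_of_neg hp (sin_neg_of_neg_of_neg_pi_lt h4 h1)
  · rw [Real.sign_of_pos h4, Real.sign_of_pos]
    exact mul_pos hp (sin_pos_of_pos_of_lt_pi h4 h2)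

/-- The defect between the signed angle from `z` to `w`, measured in right angles, and its sign. -/
noncomputable def angleDefect (z w : ℂ) : ℝ :=
  2 * Complex.arg (w / z) / π - Real.sign (Complex.arg (w / z))

theorem angleDefect_swap {z w : ℂ} (h : cross z w ≠ 0) :
    angleDefect w z = -angleDefect z w := by
  obtain ⟨-, h2, -⟩ := abs_arg_div_lt_pi h
  rw [angleDefect, angleDefect, ← inv_div w z, Complex.arg_inv, if_neg h2.ne, Real.sign_neg]
  ring

theorem sign_mul (x y : ℝ) : Real.sign (x * y) = Real.sign x * Real.sign y := by
  rcases lt_trichotomy x 0 with hx | hx | hx <;> rcases lt_trichotomy y 0 with hy | hy | hy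
  · simp [Real.sign_of_neg hx, Real.sign_of_neg hy, Real.sign_of_pos (mul_pos_of_neg_of_neg hx hy)]
  · simp [hy]
  · simp [Real.sign_of_neg hx, Real.sign_of_pos hy, Real.sign_of_neg (mul_neg_of_neg_of_pos hx hy)]
  · simp [hx]
  · simp [hx]
  · simp [hx]
  · simp [Real.sign_of_pos hx, Real.sign_of_neg hy, Real.sign_of_neg (mul_neg_of_pos_of_neg hx hy)]
  · simp [hy]
  · simp [Real.sign_of_pos hx, Real.sign_of_pos hy, Real.sign_of_pos (mul_pos hx hy)]

/-- The angle defects of a triangle add up to its orientation. -/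
theorem angleDefect_add_add {x y z : ℂ} (hxy : cross x y ≠ 0) (hyz : cross y z ≠ 0)
    (hzx : cross z x ≠ 0) :
    angleDefect x y + angleDefect y z + angleDefect z x =
      Real.sign (cross x y * cross y z * cross z x) := by
  have hx : x ≠ 0 := fun h0 => hxy (by simp [h0, cross])
  have hy : y ≠ 0 := fun h0 => hyz (by simp [h0, cross])
  have hz : z ≠ 0 := fun h0 => hzx (by simp [h0, cross])
  rw [sign_mul, sign_mul, sign_cross hxy, sign_cross hyz, sign_cross hzx]
  obtain ⟨a1, a2, a3⟩ := abs_arg_div_lt_pi hxy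
  obtain ⟨b1, b2, b3⟩ := abs_arg_div_lt_pi hyz
  obtain ⟨c1, c2, c3⟩ := abs_arg_div_lt_pi hzx
  have hsum : ((Complex.arg (y / x) + Complex.arg (z / y) + Complex.arg (x / z) : ℝ) : Angle) =
      0 := by
    rw [Angle.coe_add, Angle.coe_add, ← Complex.arg_mul_coe_angle (div_ne_zero hy hx) (div_ne_zero hz hy),
      ← Complex.arg_mul_coe_angle (mul_ne_zero (div_ne_zero hy hx) (div_ne_zero hz hy))
        (div_ne_zero hx hz)]
    have : y / x * (z / y) * (x / z) = 1 := by field_simp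
    rw [this, Complex.arg_one, Angle.coe_zero]
  obtain ⟨k, hk⟩ := Angle.coe_eq_zero_iff.1 hsum
  simp only [angleDefect]
  generalize Complex.arg (y / x) = α at *
  generalize Complex.arg (z / y) = β at *
  generalize Complex.arg (x / z) = γ at *
  have hπ := pi_pos
  rw [zsmul_eq_mul] at hk
  have e : 2 * α / π - Real.sign α + (2 * β / π - Real.sign β) + (2 * γ / π - Real.sign γ) =
      4 * k - (Real.sign α + Real.sign β + Real.sign γ) := by
    have : 2 * (α + β + γ) / π = 4 * k := by rw [← hk]; field_simp; ring
    rw [← this]; ring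
  rw [e]
  -- Three angles of absolute value below `π` sum to `2πk`, so `k` is `-1`, `0` or `1`; the signs of
  -- the angles then decide the claim.
  have k1 : k < 2 := by
    by_contra! h
    have : (2 : ℝ) ≤ k := by exact_mod_cast h
    nlinarith
  have k2 : -2 < k := by
    by_contra! h
    have : (k : ℝ) ≤ -2 := by exact_mod_cast h
    nlinarith
  rcases lt_or_gt_of_ne a3 with ha | ha <;> rcases lt_or_gt_of_ne b3 with hb | hb <;>
    rcases lt_or_gt_of_ne c3 with hc | hc <;>
    simp only [Real.sign_of_neg, Real.sign_of_pos, ha, hb, hc] <;>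
    interval_cases k <;> push_cast at hk ⊢ <;> first | (exfalso; linarith) | norm_num

theorem sum_sign_eq {ι : Type*} [Fintype ι] {x : ι → ℝ} (hx : ∀ i, x i ≠ 0) :
    ∑ i, Real.sign (x i) = 2 * (Nat.card {i // 0 < x i} : ℝ) - Fintype.card ι := by
  classical
  rw [Nat.card_eq_fintype_card, Fintype.card_subtype, Finset.card_filter, Nat.cast_sum,
    Finset.mul_sum, Fintype.card_eq_sum_ones, Nat.cast_sum, ← Finset.sum_sub_distrib]
  refine Finset.sum_congr rfl fun i _ => ?_
  rcases lt_or_gt_of_ne (hx i) with h | h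
  · simp [Real.sign_of_neg h, h.not_gt]
  · simp [Real.sign_of_pos h, h]; norm_num

theorem card_pos_add_card_neg {ι : Type*} [Fintype ι] {x : ι → ℝ} (hx : ∀ i, x i ≠ 0) :
    Nat.card {i // 0 < x i} + Nat.card {i // x i < 0} = Fintype.card ι := by
  classical
  rw [Nat.card_eq_fintype_card, Nat.card_eq_fintype_card, Fintype.card_subtype,
    Fintype.card_subtype, ← Finset.card_univ,
    ← Finset.card_filter_add_card_filter_not (s := Finset.univ) (fun i => 0 < x i)]
  congr 2
  refine Finset.filter_congr fun i _ => ?_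
  rw [not_lt]
  exact ⟨le_of_lt, fun h => lt_of_le_of_ne h (hx i)⟩

/-! ### The positive index of the area in terms of turns -/

section Turns

variable {m : ℕ} {u : Fin (m + 2) → ℂ}

theorem self_ne_add_one (i : Fin (m + 2)) : i ≠ i + 1 := by
  intro h
  have h1 : (1 : Fin (m + 2)) = 0 := by
    have := congrArg (fun j => j - i) h
    simpa using this.symm
  exact absurd h1 one_ne_zero

theorem leftTurns_add_rightTurns (hpar : ∀ i j, i ≠ j → cross (u i) (u j) ≠ 0) :
    leftTurns u + rightTurns u = m + 2 ∧
      leftTurns u = Nat.card {i // 0 < Complex.arg (u (i + 1) / u i)} := by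
  have harg := fun i => abs_arg_div_lt_pi (hpar i (i + 1) (self_ne_add_one i))
  have h1 : leftTurns u = Nat.card {i // 0 < Complex.arg (u (i + 1) / u i)} := by
    refine Nat.card_congr (Equiv.subtypeEquivRight fun i => ?_)
    exact ⟨fun h => h.1, fun h => ⟨h, (harg i).2.1⟩⟩
  have h2 : rightTurns u = Nat.card {i // Complex.arg (u (i + 1) / u i) < 0} := by
    refine Nat.card_congr (Equiv.subtypeEquivRight fun i => ?_)
    exact ⟨fun h => h.2, fun h => ⟨(harg i).1, h⟩⟩
  refine ⟨?_, h1⟩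
  rw [h1, h2, card_pos_add_card_neg fun i => (harg i).2.2, Fintype.card_fin]

/-- Up to a positive factor the coefficient is the orientation product of the directions `0`, `j +
1`, `j + 2`, to which the triangle identity for defects applies. -/
theorem areaCoeff_ne_zero_and_sign (hpar : ∀ i j, i ≠ j → cross (u i) (u j) ≠ 0) {j : ℕ}
    (hj : j < m) :
    areaCoeff u j ≠ 0 ∧ Real.sign (areaCoeff u j) =
      angleDefect (u 0) (u ((j + 1 : ℕ))) + angleDefect (u ((j + 1 : ℕ))) (u ((j + 2 : ℕ))) -
        angleDefect (u 0) (u ((j + 2 : ℕ))) := by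
  have h1 : cross (u 0) (u ((j + 1 : ℕ))) ≠ 0 :=
    hpar _ _ (natCast_ne_zero_of_lt (by omega) (by omega)).symm
  have h2 : cross (u 0) (u ((j + 2 : ℕ))) ≠ 0 :=
    hpar _ _ (natCast_ne_zero_of_lt (by omega) (by omega)).symm
  have h12 : cross (u ((j + 1 : ℕ))) (u ((j + 2 : ℕ))) ≠ 0 := by
    refine hpar _ _ ?_
    have := self_ne_add_one (m := m) ((j + 1 : ℕ))
    rwa [← Nat.cast_succ] at this
  have h3 : cross (u ((j + 2 : ℕ))) (u 0) ≠ 0 := by rwa [cross_comm, neg_ne_zero]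
  refine ⟨div_ne_zero (neg_ne_zero.2 h12) (mul_ne_zero two_ne_zero (mul_ne_zero h1 h2)), ?_⟩
  rw [sub_eq_add_neg, ← angleDefect_swap h2, angleDefect_add_add h1 h12 h3]
  have hsq : 0 < 2 * (cross (u 0) (u ((j + 1 : ℕ))) * cross (u 0) (u ((j + 2 : ℕ)))) ^ 2 := by
    positivity
  have e : cross (u 0) (u ((j + 1 : ℕ))) * cross (u ((j + 1 : ℕ))) (u ((j + 2 : ℕ))) *
      cross (u ((j + 2 : ℕ))) (u 0) = areaCoeff u j *
        (2 * (cross (u 0) (u ((j + 1 : ℕ))) * cross (u 0) (u ((j + 2 : ℕ)))) ^ 2) := by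
    rw [cross_comm (u ((j + 2 : ℕ))) (u 0), areaCoeff]
    field_simp
  rw [e, sign_mul, Real.sign_of_pos hsq, mul_one]

/-- The positive index of the area form is determined by the turns of the directions. -/
theorem card_areaCoeff_pos (hpar : ∀ i j, i ≠ j → cross (u i) (u j) ≠ 0) :
    (Nat.card {j : Fin m // 0 < areaCoeff u j} : ℝ) =
      rightTurns u - 1 + 2 * ((∑ i, Complex.arg (u (i + 1) / u i)) / (2 * π)) := by
  obtain ⟨h1, h2⟩ := leftTurns_add_rightTurns hpar
  have harg := fun i => abs_arg_div_lt_pi (hpar i (i + 1) (self_ne_add_one i))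
  have hs1 := sum_sign_eq (fun j : Fin m => (areaCoeff_ne_zero_and_sign hpar j.2).1)
  have hs2 := sum_sign_eq fun i => (harg i).2.2
  -- The defects from `u 0` telescope; their two boundary terms are the cyclic pairs that contain `u
  -- 0`.
  have htel : ∑ j : Fin m, Real.sign (areaCoeff u j) = ∑ i, angleDefect (u i) (u (i + 1)) := by
    have e1 : ∑ i, angleDefect (u i) (u (i + 1)) = ∑ k ∈ Finset.range (m + 2),
        angleDefect (u (k : ℕ)) (u ((k + 1 : ℕ))) := by
      rw [← Fin.sum_univ_eq_sum_range
        (fun k => angleDefect (u (k : ℕ)) (u ((k + 1 : ℕ)))) (m + 2)]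
      refine Finset.sum_congr rfl fun i _ => ?_
      rw [Nat.cast_succ, Fin.cast_val_eq_self]
    have e2 : angleDefect (u ((m + 1 : ℕ))) (u ((m + 1 + 1 : ℕ))) =
        -angleDefect (u 0) (u ((m + 1 : ℕ))) := by
      rw [show ((m + 1 + 1 : ℕ) : Fin (m + 2)) = 0 from Fin.natCast_self (m + 2)]
      exact angleDefect_swap (hpar _ _ (natCast_ne_zero_of_lt (by omega) (by omega)).symm)
    have e3 := Finset.sum_range_sub (fun j => angleDefect (u 0) (u ((j + 1 : ℕ)))) m
    rw [e1, Finset.sum_range_succ, Finset.sum_range_succ', e2]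
    rw [Finset.sum_congr rfl fun (j : Fin m) _ => (areaCoeff_ne_zero_and_sign hpar j.2).2,
      Fin.sum_univ_eq_sum_range (fun j => angleDefect (u 0) (u ((j + 1 : ℕ))) +
        angleDefect (u ((j + 1 : ℕ))) (u ((j + 2 : ℕ))) - angleDefect (u 0) (u ((j + 2 : ℕ)))) m]
    simp only [Finset.sum_add_distrib, Finset.sum_sub_distrib, add_assoc, Nat.reduceAdd,
      zero_add, Nat.cast_zero, Nat.cast_one] at e3 ⊢
    linarith
  rw [hs1] at htel
  simp only [angleDefect, Finset.sum_sub_distrib] at htel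
  rw [hs2, ← Finset.sum_div, ← Finset.mul_sum, ← h2] at htel
  simp only [Fintype.card_fin] at htel
  have h3 : (leftTurns u : ℝ) + rightTurns u = m + 2 := by exact_mod_cast h1
  push_cast at htel
  have hfin : 2 * ((∑ i, Complex.arg (u (i + 1) / u i)) / (2 * π)) =
      (2 * (∑ i, Complex.arg (u (i + 1) / u i)) / π) / 2 := by
    field_simp
  rw [hfin]
  linarith

end Turns

/-! ### The winding number of a tangential polygon -/

section Winding

open Complex in
/-- The intersection point of two tangents of a circle. -/
theorem eq_of_tangents {x y w : ℂ} {r a b θ α : ℝ} (hxy : cross x y ≠ 0)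
    (hα1 : -π < α) (hα2 : α < π) (hx : x = a * exp (θ * I)) (hy : y = b * exp ((θ + α : ℝ) * I))
    (hwx : cross x w = r * a) (hwy : cross y w = r * b) :
    w = (r / Real.cos (α / 2) : ℝ) * (I * exp ((θ + α / 2 : ℝ) * I)) := by
  have hcos : Real.cos (α / 2) ≠ 0 :=
    (Real.cos_pos_of_mem_Ioo ⟨by linarith, by linarith⟩).ne'
  set w' : ℂ := (r / Real.cos (α / 2) : ℝ) * (I * exp ((θ + α / 2 : ℝ) * I)) with hw'
  have hc : ∀ (s c : ℝ), cross (c * exp (s * I)) w' =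
      c * (r / Real.cos (α / 2)) * Real.cos (s - (θ + α / 2)) := by
    intro s c
    rw [Real.cos_sub]
    simp only [cross, hw', re_ofReal_mul, im_ofReal_mul, I_mul_re, I_mul_im,
      exp_ofReal_mul_I_re, exp_ofReal_mul_I_im]
    ring
  have h1 : cross x (w - w') = 0 := by
    rw [cross_sub_right, hwx, hx, hc, show θ - (θ + α / 2) = -(α / 2) by ring, Real.cos_neg]
    field_simp; ring
  have h2 : cross y (w - w') = 0 := by
    rw [cross_sub_right, hwy, hy, hc, show θ + α - (θ + α / 2) = α / 2 by ring]
    field_simp; ring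
  have hx0 : x ≠ 0 := fun h0 => hxy (by simp [h0, cross])
  obtain ⟨t, ht⟩ := exists_smul_of_cross_eq_zero hx0 h1
  rw [ht, cross_smul_right, cross_comm, mul_neg, neg_eq_zero] at h2
  rw [(mul_eq_zero.1 h2).resolve_right hxy, zero_smul] at ht
  exact sub_eq_zero.1 ht

open Complex in
-- Seen from the centre, a vertex lies in the bisecting direction of its two edge directions,
-- rotated by a right angle. The factors `1 / cos` are positive and `r` cancels in the quotient, so
-- the sign of `r` plays no role; the mean of the two turns lies in `(-π, π)` and is the principal
-- argument.
theorem arg_div_of_tangents {x y z w w' : ℂ} {r : ℝ} (hr : r ≠ 0) (hxy : cross x y ≠ 0)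
    (hyz : cross y z ≠ 0) (h1 : cross x w = r * ‖x‖) (h2 : cross y w = r * ‖y‖)
    (h3 : cross y w' = r * ‖y‖) (h4 : cross z w' = r * ‖z‖) :
    arg (w' / w) = (arg (y / x) + arg (z / y)) / 2 := by
  obtain ⟨a1, a2, -⟩ := abs_arg_div_lt_pi hxy
  obtain ⟨b1, b2, -⟩ := abs_arg_div_lt_pi hyz
  have hx : x ≠ 0 := fun h0 => hxy (by simp [h0, cross])
  have hy : y ≠ 0 := fun h0 => hyz (by simp [h0, cross])
  have hx' : (‖x‖ : ℂ) ≠ 0 := by exact_mod_cast norm_ne_zero_iff.2 hx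
  have hy' : (‖y‖ : ℂ) ≠ 0 := by exact_mod_cast norm_ne_zero_iff.2 hy
  have ey : y = ‖y‖ * exp (arg y * I) := (norm_mul_exp_arg_mul_I y).symm
  have ez : z = ‖z‖ * exp ((arg y + arg (z / y) : ℝ) * I) := by
    have h := norm_mul_exp_arg_mul_I (z / y)
    rw [norm_div, ofReal_div, eq_div_iff hy] at h
    calc z = ‖z‖ / ‖y‖ * exp (arg (z / y) * I) * (‖y‖ * exp (arg y * I)) := by rw [← ey, h]
      _ = _ := by
        push_cast
        rw [add_mul, Complex.exp_add]
        field_simp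
  have ex : x = ‖x‖ * exp ((arg y - arg (y / x) : ℝ) * I) := by
    have h := norm_mul_exp_arg_mul_I (y / x)
    rw [norm_div, ofReal_div, eq_div_iff hx] at h
    have h5 : (‖y‖ / ‖x‖ * exp (arg (y / x) * I) : ℂ) ≠ 0 :=
      mul_ne_zero (div_ne_zero hy' hx') (exp_ne_zero _)
    apply mul_left_cancel₀ h5
    rw [h]
    push_cast
    rw [sub_mul, Complex.exp_sub]
    nth_rewrite 1 [ey]
    field_simp
  have hw := eq_of_tangents hxy a1 a2 ex (by rw [sub_add_cancel]; exact ey) h1 h2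
  have hw' := eq_of_tangents hyz b1 b2 ey ez h3 h4
  have c1 : 0 < Real.cos (arg (y / x) / 2) :=
    Real.cos_pos_of_mem_Ioo ⟨by linarith, by linarith⟩
  have c2 : 0 < Real.cos (arg (z / y) / 2) :=
    Real.cos_pos_of_mem_Ioo ⟨by linarith, by linarith⟩
  have hq : w' / w = (Real.cos (arg (y / x) / 2) / Real.cos (arg (z / y) / 2) : ℝ) *
      exp (((arg (y / x) + arg (z / y)) / 2 : ℝ) * I) := by
    rw [hw, hw']
    have e : exp ((arg y + arg (z / y) / 2 : ℝ) * I) =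
        exp ((arg y - arg (y / x) + arg (y / x) / 2 : ℝ) * I) *
          exp (((arg (y / x) + arg (z / y)) / 2 : ℝ) * I) := by
      rw [← Complex.exp_add]
      congr 1
      push_cast; ring
    rw [e]
    have c1' : (Real.cos (arg (y / x) / 2) : ℂ) ≠ 0 := by exact_mod_cast c1.ne'
    have c2' : (Real.cos (arg (z / y) / 2) : ℂ) ≠ 0 := by exact_mod_cast c2.ne'
    have hr' : (r : ℂ) ≠ 0 := by exact_mod_cast hr
    have e0 := exp_ne_zero ((arg y - arg (y / x) + arg (y / x) / 2 : ℝ) * I)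
    have hI := I_ne_zero
    generalize exp ((arg y - arg (y / x) + arg (y / x) / 2 : ℝ) * I) = A at *
    generalize exp (((arg (y / x) + arg (z / y)) / 2 : ℝ) * I) = C at *
    rw [ofReal_div, ofReal_div, ofReal_div]
    generalize (Real.cos (arg (y / x) / 2) : ℂ) = k at *
    generalize (Real.cos (arg (z / y) / 2) : ℂ) = l at *
    field_simp
  rw [hq, exp_mul_I]
  exact arg_mul_cos_add_sin_mul_I (div_pos c1 c2) ⟨by linarith, by linarith⟩

/-- Each edge is seen under the mean of the turns at its two ends, so the cyclic sum counts every
turn twice with weight one half. -/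
theorem windingNumber_of_tangential {m : ℕ} {u Q : Fin (m + 2) → ℂ} {O : ℂ} {r : ℝ} (hr : r ≠ 0)
    (hpar : ∀ i j, i ≠ j → cross (u i) (u j) ≠ 0)
    (h1 : ∀ i, cross (u i) (O - Q i) = r * ‖u i‖)
    (h2 : ∀ i, cross (u (i + 1)) (O - Q i) = r * ‖u (i + 1)‖) :
    windingNumber Q O = (∑ i, Complex.arg (u (i + 1) / u i)) / (2 * π) := by
  rw [windingNumber]
  congr 1
  have e : ∀ i, Complex.arg ((Q (i + 1) - O) / (Q i - O)) =
      Complex.arg (u (i + 1) / u i) / 2 + Complex.arg (u (i + 1 + 1) / u (i + 1)) / 2 := by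
    intro i
    rw [← neg_div_neg_eq, neg_sub, neg_sub,
      arg_div_of_tangents hr (hpar i _ (self_ne_add_one _)) (hpar (i + 1) _ (self_ne_add_one _))
        (h1 i) (h2 i) (h1 (i + 1)) (h2 (i + 1))]
    ring
  have e2 := Equiv.sum_comp (Equiv.addRight (1 : Fin (m + 2)))
    (fun i => Complex.arg (u (i + 1) / u i) / 2)
  simp only [Equiv.coe_addRight] at e2
  rw [Finset.sum_congr rfl fun i _ => e i, Finset.sum_add_distrib, e2, ← Finset.sum_add_distrib]
  exact Finset.sum_congr rfl fun i _ => by ring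

/-- A common point of line and circle bounds the distance from the centre to the line by `|r|`. The
side condition, tested at the point of the circle extreme in the normal direction, gives the
opposite bound and the sign. -/
theorem cross_of_isInscribedCircle {n : ℕ} {u v : Fin n → ℂ} {O : ℂ} {r : ℝ} (hu : ∀ i, u i ≠ 0)
    (h : IsInscribedCircle u v O r) (i : Fin n) : cross (u i) (O - v i) = r * ‖u i‖ := by
  obtain ⟨hr, ht, hl, hr'⟩ := h
  obtain ⟨z, ⟨⟨t, hz⟩, hzs⟩, -⟩ := ht i
  have hn : ‖u i‖ ≠ 0 := norm_ne_zero_iff.2 (hu i)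
  have hb : |cross (u i) (O - v i)| ≤ |r| * ‖u i‖ := by
    have h1 : cross (u i) (O - v i) = cross (u i) (O - z) := by
      rw [hz, ← sub_sub, cross_sub_right _ _ (t • u i), cross_smul_right, cross_self]; ring
    have h2 : ‖O - z‖ = |r| := by
      rw [← dist_eq_norm, dist_comm]; exact hzs
    rw [h1, mul_comm, ← h2]
    exact abs_cross_le _ _
  have hmem : O + (-r / ‖u i‖) • (Complex.I * u i) ∈ Metric.sphere O |r| := by
    rw [mem_sphere_iff_norm, add_sub_cancel_left, norm_smul, norm_mul, Complex.norm_I, one_mul,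
      Real.norm_eq_abs, abs_div, abs_neg, abs_norm, div_mul_cancel₀ _ hn]
  have hval : cross (u i) (O + (-r / ‖u i‖) • (Complex.I * u i) - v i) =
      cross (u i) (O - v i) - r * ‖u i‖ := by
    rw [add_sub_right_comm, cross_add_right, cross_smul_right, cross_I_mul_self]
    field_simp; ring
  have hb' := abs_le.1 hb
  rcases lt_or_gt_of_ne hr with h0 | h0
  · have h1 := hr' h0 i _ hmem
    rw [hval] at h1
    rw [abs_of_neg h0] at hb'
    linarith [hb'.1]
  · have h1 := hl h0 i _ hmem
    rw [hval] at h1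
    rw [abs_of_pos h0] at hb'
    linarith [hb'.2]

theorem cross_next_of_isInscribedCircle {n : ℕ} [NeZero n] {u : Fin n → ℂ} {Q : Polygons u} {O : ℂ}
    {r : ℝ} (hu : ∀ i, u i ≠ 0) (h : IsInscribedCircle u (Q : Fin n → ℂ) O r) (i : Fin n) :
    cross (u (i + 1)) (O - (Q : Fin n → ℂ) i) = r * ‖u (i + 1)‖ := by
  obtain ⟨t, ht⟩ := exists_edge_eq_smul Q (i + 1)
  rw [add_sub_cancel_right] at ht
  rw [← cross_of_isInscribedCircle hu h (i + 1), ← sub_add_sub_cancel O _ ((Q : Fin n → ℂ) i),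
    cross_add_right, ht, cross_smul_right, cross_self, mul_zero, add_zero]

end Winding

end SlopePolygon

namespace SlopePolygon

/-! ### The perimeter as a linear function, and the two cases of the theorem -/

open Module

/-- The Morse index of the perimeter at a tangential polygon and at its opposite, in terms of the
positive and negative indices of the area form. -/
theorem exists_hasMorseIndex_perimeter {m d : ℕ} (hm : m = d + 1) {u : Fin (m + 2) → ℂ}
    (hu : ∀ i, u i ≠ 0) (hpar : ∀ i j, i ≠ j → cross (u i) (u j) ≠ 0) (Q : Polygons u)
    (hQ : Submodule.Quotient.mk Q ∈ configurationSpace u) {O : ℂ} {r : ℝ}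
    (hr : IsInscribedCircle u (Q : Fin (m + 2) → ℂ) O r) :
    (0 < r → ∃ μ : ℕ,
      HasMorseIndex d (perimeterOnConfigurationSpace u) ⟨Submodule.Quotient.mk Q, hQ⟩ μ ∧
      μ + (if 0 < perimeter u (Q : Fin (m + 2) → ℂ) then 1 else 0) =
        Nat.card {j : Fin m // 0 < areaCoeff u j}) ∧
    (r < 0 → ∃ μ μ' : ℕ,
      HasMorseIndex d (perimeterOnConfigurationSpace u) ⟨Submodule.Quotient.mk Q, hQ⟩ μ ∧
      HasMorseIndex d (perimeterOnConfigurationSpace u)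
        ⟨Submodule.Quotient.mk (-Q), neg_mem_configurationSpace hQ⟩ μ' ∧
      μ + (if 0 < perimeter u (Q : Fin (m + 2) → ℂ) then 1 else 0) =
        Nat.card {j : Fin m // areaCoeff u j < 0} ∧
      μ' + (if 0 < perimeter u (Q : Fin (m + 2) → ℂ) then 0 else 1) =
        Nat.card {j : Fin m // 0 < areaCoeff u j}) := by
  have h0 := cross_of_isInscribedCircle hu hr
  have h1 := cross_next_of_isInscribedCircle hu hr
  have hr0 : r ≠ 0 := hr.1
  obtain ⟨B, b, hB, hA, hb, hbκ⟩ :=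
    exists_area_form (hu 0) fun i hi => hpar 0 i hi.symm
  have hκ : ∀ j : Fin m, areaCoeff u j ≠ 0 := fun j => (areaCoeff_ne_zero_and_sign hpar j.2).1
  have hcard : Fintype.card (Fin m) = d + 1 := by rw [Fintype.card_fin, hm]
  set q : PolygonSpace u := Submodule.Quotient.mk Q with hq
  have hM : ∀ x, x ∈ configurationSpace u ↔ |B x x| = 1 := fun x => by rw [← hA]; rfl
  have hM' : ∀ x, x ∈ configurationSpace u ↔ |(-B) x x| = 1 := fun x => by
    rw [hM, neg_apply, neg_apply, abs_neg]
  have hP : ∀ x, perimeterMod u x = 2 / r * B q x := by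
    intro x
    obtain ⟨X, rfl⟩ := Submodule.Quotient.mk_surjective _ x
    have h2 : areaMod u (q + Submodule.Quotient.mk X) =
        areaMod u q + areaMod u (Submodule.Quotient.mk X) +
          r * perimeterMod u (Submodule.Quotient.mk X) :=
      area_add_of_tangential hu h0 h1 X
    simp only [hA, map_add, add_apply] at h2
    rw [hB (Submodule.Quotient.mk X) q] at h2
    field_simp
    linarith
  have hPQ : perimeter u (Q : Fin (m + 2) → ℂ) = 2 / r * B q q := hP q
  have hBq : B q q ≠ 0 := fun h => by
    have := (hM q).1 hQ
    rw [h, abs_zero] at this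
    exact zero_ne_one this
  rw [hPQ]
  constructor
  · intro hpos
    have ha : 0 < 2 / r := div_pos two_pos hpos
    obtain ⟨μ, hμ, e⟩ := exists_hasMorseIndex B hB hM b hb (fun j => by rw [hbκ]; exact hκ j) hcard
      ha ⟨q, hQ⟩ (perimeterOnConfigurationSpace u) (fun x => by exact hP x)
    refine ⟨μ, hμ, ?_⟩
    simp only [hbκ] at e
    simpa only [mul_pos_iff_of_pos_left ha] using e
  · intro hneg
    -- The factor `2 / r` is now negative. The minus sign goes to the form at `q` and to the point
    -- at `-q`, so the two indices count the negative and the positive coefficients respectively.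
    have ha : 0 < -(2 / r) := neg_pos.2 (div_neg_of_pos_of_neg two_pos hneg)
    obtain ⟨μ, hμ, e⟩ := exists_hasMorseIndex (-B) (fun x y => by simp [hB x y]) hM' b
      (fun i j h => by simp [hb i j h]) (fun j => by simp [hbκ, hκ j]) hcard
      ha ⟨q, hQ⟩ (perimeterOnConfigurationSpace u)
      (fun x => by rw [neg_apply, neg_apply, neg_mul_neg]; exact hP x)
    obtain ⟨μ', hμ', e'⟩ := exists_hasMorseIndex B hB hM b hb
      (fun j => by rw [hbκ]; exact hκ j) hcard
      ha ⟨-q, neg_mem_configurationSpace hQ⟩ (perimeterOnConfigurationSpace u)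
      (fun x => by rw [map_neg, neg_apply, neg_mul_neg]; exact hP x)
    have hiff : 0 < 2 / r * B q q ↔ B q q < 0 := by
      rw [← neg_mul_neg, mul_pos_iff_of_pos_left ha, neg_pos]
    refine ⟨μ, μ', hμ, hμ', ?_, ?_⟩
    · simp only [neg_apply, hbκ, neg_pos] at e
      simpa only [hiff] using e
    · simp only [map_neg, neg_apply, neg_neg, hbκ] at e'
      rw [← e']
      congr 1
      rcases lt_or_gt_of_ne hBq with h | h
      · rw [if_pos (hiff.2 h), if_neg h.not_gt]
      · rw [if_neg fun h' => h.not_gt (hiff.1 h'), if_pos h]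

end SlopePolygon

theorem mainTheorem1 (n : ℕ) [NeZero n] (hn : 3 ≤ n) (u : Fin n → ℂ)
    (hu : ∀ i, u i ≠ 0)
    (hpar : ∀ i j, i ≠ j → SlopePolygon.cross (u i) (u j) ≠ 0)
    (Q : SlopePolygon.Polygons u)
    (hQ : Submodule.Quotient.mk Q ∈ SlopePolygon.configurationSpace u)
    (O : ℂ) (r : ℝ) (hr : SlopePolygon.IsInscribedCircle u (Q : Fin n → ℂ) O r) :
    (0 < r → ∃ μ : ℕ,
      SlopePolygon.HasMorseIndex (n - 3) (SlopePolygon.perimeterOnConfigurationSpace u)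
        ⟨Submodule.Quotient.mk Q, hQ⟩ μ ∧
      (μ : ℝ) = SlopePolygon.rightTurns u - 1 + 2 * SlopePolygon.windingNumber (Q : Fin n → ℂ) O
        - (if 0 < SlopePolygon.perimeter u (Q : Fin n → ℂ) then 1 else 0)) ∧
    (r < 0 → ∃ μ μ' : ℕ,
      SlopePolygon.HasMorseIndex (n - 3) (SlopePolygon.perimeterOnConfigurationSpace u)
        ⟨Submodule.Quotient.mk Q, hQ⟩ μ ∧
      SlopePolygon.HasMorseIndex (n - 3) (SlopePolygon.perimeterOnConfigurationSpace u)
        ⟨Submodule.Quotient.mk (-Q), SlopePolygon.neg_mem_configurationSpace hQ⟩ μ' ∧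
      (μ : ℝ) = (n : ℝ) - 3 - μ' ∧
      (μ : ℝ) = SlopePolygon.leftTurns u - 1 - 2 * SlopePolygon.windingNumber (Q : Fin n → ℂ) O
        - (if 0 < SlopePolygon.perimeter u (Q : Fin n → ℂ) then 1 else 0)) := by
  -- Here `d` is the dimension of the configuration space and `d + 1` that of the space of polygons
  -- modulo translations.
  obtain ⟨d, rfl⟩ : ∃ d, n = d + 1 + 2 := ⟨n - 3, by omega⟩
  have hw := SlopePolygon.windingNumber_of_tangential hr.1 hpar
    (SlopePolygon.cross_of_isInscribedCircle hu hr)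
    (SlopePolygon.cross_next_of_isInscribedCircle hu hr)
  have hpos := SlopePolygon.card_areaCoeff_pos hpar
  rw [← hw] at hpos
  have hturns := (SlopePolygon.leftTurns_add_rightTurns hpar).1
  have hpn := SlopePolygon.card_pos_add_card_neg
    (fun j : Fin (d + 1) => (SlopePolygon.areaCoeff_ne_zero_and_sign hpar j.2).1)
  rw [Fintype.card_fin] at hpn
  obtain ⟨h1, h2⟩ := SlopePolygon.exists_hasMorseIndex_perimeter rfl hu hpar Q hQ hr
  have hturns' : (SlopePolygon.leftTurns u : ℝ) + SlopePolygon.rightTurns u = d + 1 + 2 := by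
    exact_mod_cast hturns
  have hpn' := congrArg (Nat.cast (R := ℝ)) hpn
  push_cast at hpn'
  refine ⟨fun h => ?_, fun h => ?_⟩
  · obtain ⟨μ, hμ, e⟩ := h1 h
    refine ⟨μ, hμ, ?_⟩
    rw [← hpos, ← e]
    push_cast
    ring
  · obtain ⟨μ, μ', hμ, hμ', e, e'⟩ := h2 h
    have e1 := congrArg (Nat.cast (R := ℝ)) e
    have e2 := congrArg (Nat.cast (R := ℝ)) e'
    push_cast at e1 e2 ⊢
    -- The positive and negative indices sum to `n - 2`, and left and right turns to `n`; exactly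
    -- one of the two points loses one from its index.
    refine ⟨μ, μ', hμ, hμ', ?_, ?_⟩ <;> split_ifs at e1 e2 ⊢ <;> linarith
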